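/- **Setting.** The state is $u=(u_1,u_2,u_3)\in\mathbb R^3$ (Euclidean norm). The fixed parameters are $0<D_1<D_3$, $\tilde D_{2,1}>0$, $\tilde\alpha>0$, $\Omega\in(0,1)$, and $\lambda>0$ is the small parameter. Put $D_2:=D_1+\lambda\tilde D_{2,1}$, $D_{3,1}:=D_3-D_1$, $D_{3,2}:=D_3-D_2$, $\tilde h_2:=-\tilde D_{2,1}\Omega$, $\gamma:=\sqrt{1-\Omega^2}$, $s^{\pm}:=(\pm\gamma,-\Omega,0)$. The scaled Landau–Lifshitz–Slonczewski system with control (injected current) $\tilde\beta(t)$ is $$\begin{aligned} \dot u_1&=D_{3,2}u_2u_3+\lambda\left[\tilde h_2u_3+u_1u_3\tilde\beta(t)+\tilde\alpha u_1D_{3,1}u_3^2\right]+\tilde\alpha\lambda^2u_1u_2\left[\tilde D_{2,1}u_2-\tilde h_2\right],\\ \dot u_2&=-D_{3,1}u_1u_3+\lambda u_2u_3\left[\tilde\beta(t)+\tilde\alpha D_{3,2}u_3\right]+\tilde\alpha\lambda^2\left[\tilde h_2(u_1^2+u_3^2)-\tilde D_{2,1}u_1^2u_2\right],\\ \dot u_3&=\lambda\left[-\tilde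 h_2u_1+u_1u_2\tilde D_{2,1}-(u_1^2+u_2^2)\tilde\beta(t)-\tilde\alpha u_3(D_{3,2}u_2^2+D_{3,1}u_1^2)\right]-\tilde\alpha\tilde h_2\lambda^2u_2u_3 . \end{aligned}$$ For a piecewise control, a solution on $[-T_e,\infty)$ is a continuous curve which satisfies the system at every time $t>-T_e$ other than the two switching times. **The transfer current.** Let $K>0$ and let $(w_1^0,w_2^0)\in\mathbb R^2$. Put $\sigma:=\sqrt{D_{3,2}/D_{3,1}}$, $\omega:=K\sqrt{D_{3,2}D_{3,1}}$, $\rho:=1/(1-K^2)$. The latitudinal feedback $$\hat\beta_{lat}(v_1,v_2):=\frac{v_1v_2\tilde D_{2,1}+\tilde\alpha K(D_{3,2}v_2^2+D_{3,1}v_1^2)+\tilde\alpha\tilde h_2\lambda v_2K-\tilde h_2v_1}{v_1^2+v_2^2}$$ is the value of the current for which $\dot u_3=0$ at $(v_1,v_2,-K)$. For $X_a,X_b\in\mathbb R$ let $$\begin{aligned} W_1(t;X_a,X_b)&:=\tfrac{K\rho}{\omega}\Big\{\tilde D_{2,1}\sigma^2(X_a^2+X_b^2)[X_a\cos\omega t-X_b\sin\omega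 t]+\tfrac23\tilde h_2(\sigma^2+2)[2X_aX_b\cos2\omega t-(X_b^2-X_a^2)\sin2\omega t]\\ &\qquad-\tilde D_{2,1}\sigma^2[X_a(3X_b^2-X_a^2)\cos3\omega t-X_b(X_b^2-3X_a^2)\sin3\omega t]\Big\},\\ W_2(t;X_a,X_b)&:=\tfrac{K\rho}{\omega}\Big\{-\tilde D_{2,1}\sigma(X_a^2+X_b^2)[X_b\cos\omega t+X_a\sin\omega t]+\tfrac23\tilde h_2(2\sigma^2+1)[(X_b^2-X_a^2)\cos2\omega t+2X_aX_b\sin2\omega t]\\ &\qquad-\tilde D_{2,1}\sigma[X_b(X_b^2-3X_a^2)\cos3\omega t+X_a(3X_b^2-X_a^2)\sin3\omega t]-2\tilde h_2(X_a^2+X_b^2)/\sigma\Big\}. \end{aligned}$$ With $x_a:=w_1^0/(2\sigma)$, $x_b:=w_2^0/2$, $X_a:=x_a-\lambda W_1(0;x_a,x_b)/(2\sigma)$ and $X_b:=x_b-\lambda W_2(0;x_a,x_b)/2$, put $$\begin{aligned} w_1(t)&:=2\sigma(X_a\cos\omega t-X_b\sin\omega t)+\lambda W_1(t;X_a,X_b),\\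 w_2(t)&:=2(X_b\cos\omega t+X_a\sin\omega t)+\lambda W_2(t;X_a,X_b), \end{aligned}$$ the first-order approximation, started at $(w_1^0,w_2^0)$, of the motion on the latitude $u_3=-K$ that the feedback $\hat\beta_{lat}$ produces. The transfer current is $\tilde\beta_{tr}(t):=\hat\beta_{lat}(w_1(t),w_2(t))$. **Theorem.** Let $0<a<1$ and $b>a$, and let $\mathcal P_{a,b}$ be the set of all $(D_1,D_3,\tilde D_{2,1},\tilde\alpha,\Omega)$ with $D_1>0$, $D_3-D_1\in[a,b]$, $\tilde D_{2,1}\in[a,b]$, $0<\tilde\alpha\le b$, $0<\Omega\le1-a$. There exist $\lambda_0,\kappa,\tilde\beta_e,C>0$, depending only on $a,b$, with $\lambda_0b<a$ (so that $D_1<D_2<D_3$ for $\lambda\le\lambda_0$) and $\sqrt2\,\kappa\sqrt{\lambda_0}\le1$, such that the following holds for every parameter tuple in $\mathcal P_{a,b}$ and every $\lambda\in(0,\lambda_0]$. Put $K:=\kappa\sqrt\lambda$. There exist $T_e,T_{tr}>0$ and $(w_1^0,w_2^0)\in\mathbb R^2$ such that, for the control $$\tilde\beta(t):=\begin{cases}\tilde\beta_e,&t\in[-T_e,0),\\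 \tilde\beta_{tr}(t),&t\in[0,T_{tr}],\\ 0,&t>T_{tr},\end{cases}$$ 1. a solution with $u(-T_e)=s^-$ satisfies $u(0)=(w_1^0,w_2^0,-K)$; 2. for every $f>1/\gamma$ there is $r^->0$ such that, for every $r\le r^-$ and every $u_0$ in the closed ball $\mathfrak B_r(s^-)$ of $\mathbb R^3$, there is exactly one solution $u$ on $[-T_e,\infty)$ with $u(-T_e)=u_0$; the limit $\lim_{t\to+\infty}u(t)$ exists and lies in the closed ball $\mathfrak B_{fr}(s^+)$; and on $[0,T_{tr}]$ the solution is controlled quasi-latitudinal: its control there is the transfer current, $|u_3(t)+K|\le C\lambda$ for all $t\in[0,T_{tr}]$, and $|u(T_{tr})-s^+|\le C\sqrt\lambda$. -/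

import Mathlib

open Filter Topology Set

noncomputable section

namespace LLS

/-- The state space `ℝ³` with the Euclidean norm. -/
abbrev E3 : Type := EuclideanSpace ℝ (Fin 3)

/-- The parameters of the scaled system which do not depend on the small parameter `lam`:
the demagnetizing factors `D₁`, `D₃`, the scaled difference `Dt21 = (D₂ - D₁) / lam`, the scaled
damping `αt = α / lam`, and `Ω`, which fixes the applied field through `h₂ = -(D₂ - D₁) Ω`. -/
structure Params where
  D1 : ℝ
  D3 : ℝ
  Dt21 : ℝ
  αt : ℝ
  Ω : ℝ

namespace Params

variable (p : Params) (lam : ℝ)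

/-- The intermediate demagnetizing factor `D₂ = D₁ + lam Dt21`. -/
def D2 : ℝ := p.D1 + lam * p.Dt21

/-- `D₃ - D₁`. -/
def D31 : ℝ := p.D3 - p.D1

/-- `D₃ - D₂`. -/
def D32 : ℝ := p.D3 - p.D2 lam

/-- The scaled applied field `h₂ / lam`. -/
def ht2 : ℝ := -(p.Dt21 * p.Ω)

/-- `γ = √(1 - Ω²)`. -/
def γ : ℝ := √(1 - p.Ω ^ 2)

/-- The initial equilibrium `s⁻` (at zero current). -/
def sMinus : E3 := !₂[-p.γ, -p.Ω, 0]

/-- The target equilibrium `s⁺` (at zero current). -/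
def sPlus : E3 := !₂[p.γ, -p.Ω, 0]

/-- The right-hand side of the scaled Landau-Lifshitz-Slonczewski system at the state `u`
when the (scaled) injected current has the value `β`. -/
def field (β : ℝ) (u : E3) : E3 :=
  !₂[p.D32 lam * u 1 * u 2
      + lam * (p.ht2 * u 2 + u 0 * u 2 * β + p.αt * u 0 * p.D31 * u 2 ^ 2)
      + p.αt * lam ^ 2 * u 0 * u 1 * (p.Dt21 * u 1 - p.ht2),
    -(p.D31 * u 0 * u 2)
      + lam * u 1 * u 2 * (β + p.αt * p.D32 lam * u 2)
      + p.αt * lam ^ 2 * (p.ht2 * (u 0 ^ 2 + u 2 ^ 2) - p.Dt21 * u 0 ^ 2 * u 1),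
    lam * (-(p.ht2 * u 0) + u 0 * u 1 * p.Dt21 - (u 0 ^ 2 + u 1 ^ 2) * β
        - p.αt * u 2 * (p.D32 lam * u 1 ^ 2 + p.D31 * u 0 ^ 2))
      - p.αt * p.ht2 * lam ^ 2 * u 1 * u 2]

/-- `u` solves the scaled system with control `β` on `[t₀, ∞)`: it is continuous there and satisfies
the equation at all later times outside the set `S` of switching times of the control. -/
def IsSolution (β : ℝ → ℝ) (t₀ : ℝ) (S : Set ℝ) (u : ℝ → E3) : Prop :=
  ContinuousOn u (Ici t₀) ∧
    ∀ t, t₀ < t → t ∉ S → HasDerivAt u (p.field lam (β t) (u t)) t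

/-- The latitudinal feedback: the value of the current for which the third component of the
field vanishes at `(v₁, v₂, -K)`. -/
def betaLat (K v₁ v₂ : ℝ) : ℝ :=
  (v₁ ^ 2 + v₂ ^ 2)⁻¹ *
    (v₁ * v₂ * p.Dt21 + p.αt * K * (p.D32 lam * v₂ ^ 2 + p.D31 * v₁ ^ 2)
      + p.αt * p.ht2 * lam * v₂ * K - p.ht2 * v₁)

/-- The frequency of the unperturbed latitudinal motion at height `-K`. -/
def freq (K : ℝ) : ℝ := K * √(p.D32 lam * p.D31)

/-- `σ = √(D₃₂ / D₃₁)`. -/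
def σ : ℝ := √(p.D32 lam / p.D31)

/-- First component of the unperturbed (elliptic) motion with amplitudes `Xa`, `Xb`. -/
def wZero₁ (K Xa Xb t : ℝ) : ℝ :=
  2 * p.σ lam * (Xa * Real.cos (t * p.freq lam K) - Xb * Real.sin (t * p.freq lam K))

/-- Second component of the unperturbed (elliptic) motion with amplitudes `Xa`, `Xb`. -/
def wZero₂ (K Xa Xb t : ℝ) : ℝ :=
  2 * (Xb * Real.cos (t * p.freq lam K) + Xa * Real.sin (t * p.freq lam K))

/-- First component of the first-order correction (the coefficient of `lam`), with
`1 / (1 - K²) = 1 / (v₁² + v₂²)` on the latitude `v₃ = -K` of the unit sphere. -/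
def wOne₁ (K Xa Xb t : ℝ) : ℝ :=
  (p.freq lam K)⁻¹ * K * (1 - K ^ 2)⁻¹ *
    (p.Dt21 * p.σ lam ^ 2 * (Xa ^ 2 + Xb ^ 2)
        * (Xa * Real.cos (t * p.freq lam K) - Xb * Real.sin (t * p.freq lam K))
      + 2 / 3 * p.ht2 * (p.σ lam ^ 2 + 2)
        * (2 * Xa * Xb * Real.cos (2 * t * p.freq lam K)
          - (Xb ^ 2 - Xa ^ 2) * Real.sin (2 * t * p.freq lam K))
      - p.Dt21 * p.σ lam ^ 2
        * (Xa * (3 * Xb ^ 2 - Xa ^ 2) * Real.cos (3 * t * p.freq lam K)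
          - Xb * (Xb ^ 2 - 3 * Xa ^ 2) * Real.sin (3 * t * p.freq lam K)))

/-- Second component of the first-order correction (the coefficient of `lam`). -/
def wOne₂ (K Xa Xb t : ℝ) : ℝ :=
  (p.freq lam K)⁻¹ * K * (1 - K ^ 2)⁻¹ *
    (-(p.Dt21 * p.σ lam * (Xa ^ 2 + Xb ^ 2)
        * (Xb * Real.cos (t * p.freq lam K) + Xa * Real.sin (t * p.freq lam K)))
      + 2 / 3 * p.ht2 * (2 * p.σ lam ^ 2 + 1)
        * ((Xb ^ 2 - Xa ^ 2) * Real.cos (2 * t * p.freq lam K)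
          + 2 * Xa * Xb * Real.sin (2 * t * p.freq lam K))
      - p.Dt21 * p.σ lam
        * (Xb * (Xb ^ 2 - 3 * Xa ^ 2) * Real.cos (3 * t * p.freq lam K)
          + Xa * (3 * Xb ^ 2 - Xa ^ 2) * Real.sin (3 * t * p.freq lam K))
      - 2 * p.ht2 * (Xa ^ 2 + Xb ^ 2) / p.σ lam)

/-- The amplitude `Xa` determined, to first order in `lam`, by the initial point `(w₁, w₂)`:
first component of `x - lam 𝒞(x)`, where `x` are the linear normal coordinates of the point
and `id + lam 𝒞` is the normalizing transformation. -/
def ampA (K w₁ w₂ : ℝ) : ℝ :=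
  w₁ / (2 * p.σ lam) - lam * p.wOne₁ lam K (w₁ / (2 * p.σ lam)) (w₂ / 2) 0 / (2 * p.σ lam)

/-- The amplitude `Xb` determined, to first order in `lam`, by the initial point `(w₁, w₂)`. -/
def ampB (K w₁ w₂ : ℝ) : ℝ :=
  w₂ / 2 - lam * p.wOne₂ lam K (w₁ / (2 * p.σ lam)) (w₂ / 2) 0 / 2

/-- First component of the first-order approximate solution, started at `(w₁, w₂)`,
of the latitudinal system at height `-K`. -/
def wApprox₁ (K w₁ w₂ t : ℝ) : ℝ :=
  p.wZero₁ lam K (p.ampA lam K w₁ w₂) (p.ampB lam K w₁ w₂) t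
    + lam * p.wOne₁ lam K (p.ampA lam K w₁ w₂) (p.ampB lam K w₁ w₂) t

/-- Second component of the first-order approximate solution, started at `(w₁, w₂)`,
of the latitudinal system at height `-K`. -/
def wApprox₂ (K w₁ w₂ t : ℝ) : ℝ :=
  p.wZero₂ lam K (p.ampA lam K w₁ w₂) (p.ampB lam K w₁ w₂) t
    + lam * p.wOne₂ lam K (p.ampA lam K w₁ w₂) (p.ampB lam K w₁ w₂) t

/-- The transfer current: the latitudinal feedback evaluated along the approximate
latitudinal solution started at `(w₁, w₂)`. -/
def betaTr (K w₁ w₂ t : ℝ) : ℝ :=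
  p.betaLat lam K (p.wApprox₁ lam K w₁ w₂ t) (p.wApprox₂ lam K w₁ w₂ t)

/-- A controlled quasi-latitudinal solution on `[0, Ttr]` (at height `-K`, with tolerance constant
`C`): the control is the transfer current, the third variable stays `C lam`-close to `-K`,
and at the end of the transfer a `C √lam`-neighbourhood of the target `s⁺` is reached. -/
def IsCQL (K C w₁ w₂ Ttr : ℝ) (β : ℝ → ℝ) (u : ℝ → E3) : Prop :=
  (∀ t ∈ Icc 0 Ttr, β t = p.betaTr lam K w₁ w₂ t) ∧
    (∀ t ∈ Icc 0 Ttr, |u t 2 - (-K)| ≤ C * lam) ∧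
    dist (u Ttr) p.sPlus ≤ C * √lam

end Params

/-- The piecewise control: the constant `βe` before time `0`, the current `βtr` on `[0, Ttr]`,
and no current afterwards. -/
def control (βe : ℝ) (βtr : ℝ → ℝ) (Ttr t : ℝ) : ℝ :=
  if t < 0 then βe else if t ≤ Ttr then βtr t else 0

/-- The set of parameters: `D₁`, `D₃`, `Dt21`, `αt` positive, with `D₃ - D₁` and `Dt21` between `a`
and `b`, `αt` at most `b`, and `0 < Ω ≤ 1 - a`. Every tuple of parameters with `0 < D₁ < D₃`,
`0 < Dt21`, `0 < αt`, `0 < Ω < 1` lies in one of these sets. -/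
def paramSet (a b : ℝ) : Set Params :=
  {p | 0 < p.D1 ∧ p.D31 ∈ Icc a b ∧ p.Dt21 ∈ Icc a b ∧ p.αt ∈ Ioc 0 b ∧ p.Ω ∈ Ioc 0 (1 - a)}

end LLS

end

/-!
The control acts in three phases, and each is governed by an elementary estimate on the unit sphere
(all fields are tangent to the spheres about the origin, so the norm is preserved and solutions are
global).

*Escape.* A large constant current forces `u₃' ≤ -lam` as long as `u₃² ≤ 1/2`, whatever the other
components do. Hence the solution started at `s⁻` reaches the latitude `-K`, in time at most
`3 K / lam`; the point reached defines `(w₁, w₂)` (`Solves.exists_reach`).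

*Transfer.* On the latitude `-K`, the motion is to leading order the rotation of angular velocity
about `K D₃₁` along an ellipse through `(w₁, w₂)`, which is `O(lam)`-close to the unit circle. The
first-order correction in the approximate motion is bounded, so the approximate motion is
`O(lam)`-close to the ellipse too. The transfer current makes `u₃'` vanish on the approximate
motion; therefore `u₃' = lam O(deviation)`, and in the variables `u₁ - e₁`, `u₂ - e₂`, `(u₃ + K) / √lam`,
with `e` the ellipse, the squared deviation `S` satisfies `S' ≤ c √lam (S + lam)`. As the ellipse
needs a time `O(1 / √lam)` to arrive near `s⁺`, Grönwall's inequality gives `S = O(lam)`: the height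
varies by `O(lam)` and the distance to `s⁺` at the end is `O(√lam)` (`Solves.sq_dist_ellipse_le`,
`exists_transfer`).

*Relaxation.* Without current the energy `D₃₁ u₃² + lam Dt21 (u₂ + Ω)²` decreases. The barrier
between the two equilibria has height of order `lam`, while the energy at the end of the transfer is
at most a small multiple of `lam` if `κ` and `lam` are small. Below a quarter of the barrier `u₁`
stays away from zero, the energy decays exponentially, and the solution converges to the equilibrium
`(√(R² - Ω²), -Ω, 0)` of its sphere of radius `R` (`Solves.tendsto_equilibrium`).

Solutions started near `s⁻` stay close to the reference solution up to the end of the transfer, by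
continuous dependence, and then lie in the same open part of the basin. Their limits are
`O(|R - 1|)`-close to `s⁺` with a constant arbitrarily close to `1 / γ`, the derivative of
`√(R² - Ω²)` at `R = 1`.
-/

noncomputable section

/-! ### Control-affine differential equations with tangential fields -/

namespace LLS

/-- Linear Grönwall inequality for scalar functions: no sign is assumed on `f` or `k`, and nothing
is required of the derivative at the endpoints. -/
theorem le_mul_exp_of_hasDerivAt_le {f f' : ℝ → ℝ} {t₀ t₁ k : ℝ}
    (hf : ContinuousOn f (Icc t₀ t₁)) (hf' : ∀ t ∈ Ioo t₀ t₁, HasDerivAt f (f' t) t)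
    (hk : ∀ t ∈ Ioo t₀ t₁, f' t ≤ k * f t) {t : ℝ} (ht : t ∈ Icc t₀ t₁) :
    f t ≤ f t₀ * Real.exp (k * (t - t₀)) := by
  have hexp : ∀ t, HasDerivAt (fun t => Real.exp (-(k * (t - t₀))))
      (Real.exp (-(k * (t - t₀))) * (-k)) t := by
    intro t
    have h : HasDerivAt (fun t : ℝ => -(k * (t - t₀))) (-k) t := by
      simpa using (((hasDerivAt_id' t).sub_const t₀).const_mul k).fun_neg
    exact h.exp
  have hanti : AntitoneOn (fun t => f t * Real.exp (-(k * (t - t₀)))) (Icc t₀ t₁) := by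
    refine antitoneOn_of_hasDerivWithinAt_nonpos (convex_Icc _ _)
      (f' := fun t => f' t * Real.exp (-(k * (t - t₀)))
        + f t * (Real.exp (-(k * (t - t₀))) * (-k))) ?_ ?_ ?_
    · exact hf.mul (fun t _ => (hexp t).continuousAt.continuousWithinAt)
    · intro s hs
      rw [interior_Icc] at hs
      exact ((hf' s hs).mul (hexp s)).hasDerivWithinAt
    · intro s hs
      rw [interior_Icc] at hs
      have := mul_nonneg (sub_nonneg.2 (hk s hs)) (Real.exp_pos (-(k * (s - t₀)))).le
      nlinarith
  have h := hanti (left_mem_Icc.2 (ht.1.trans ht.2)) ht ht.1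
  simp only [sub_self, mul_zero, neg_zero, Real.exp_zero, mul_one] at h
  have h2 := mul_le_mul_of_nonneg_right h (Real.exp_pos (k * (t - t₀))).le
  rwa [mul_assoc, ← Real.exp_add, neg_add_cancel, Real.exp_zero, mul_one] at h2

/-- `u` solves `u' = F u + β G u` on `[t₀, t₁]`: it is continuous there and differentiable at
interior times. -/
def SolvesOn (F G : E3 → E3) (β : ℝ → ℝ) (t₀ t₁ : ℝ) (u : ℝ → E3) : Prop :=
  ContinuousOn u (Icc t₀ t₁) ∧
    ∀ t ∈ Ioo t₀ t₁, HasDerivAt u (F (u t) + β t • G (u t)) t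

variable {F G : E3 → E3} {β : ℝ → ℝ} {t₀ t₁ t₂ : ℝ} {u v : ℝ → E3}

theorem SolvesOn.mono (hu : SolvesOn F G β t₀ t₂ u) (h : t₁ ≤ t₂) : SolvesOn F G β t₀ t₁ u :=
  ⟨hu.1.mono (Icc_subset_Icc_right h), fun t ht => hu.2 t ⟨ht.1, ht.2.trans_le h⟩⟩

theorem SolvesOn.congr_control {β' : ℝ → ℝ} (hu : SolvesOn F G β t₀ t₁ u)
    (h : EqOn β β' (Ioo t₀ t₁)) : SolvesOn F G β' t₀ t₁ u :=
  ⟨hu.1, fun t ht => h ht ▸ hu.2 t ht⟩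

/-- Fields tangent to the spheres about the origin preserve the norm. -/
theorem SolvesOn.norm_eq (hu : SolvesOn F G β t₀ t₁ u) (hF : ∀ x, inner ℝ x (F x) = 0)
    (hG : ∀ x, inner ℝ x (G x) = 0) {t : ℝ} (ht : t ∈ Icc t₀ t₁) : ‖u t‖ = ‖u t₀‖ := by
  have hd : ∀ s ∈ Ioo t₀ t₁, HasDerivAt (fun s => ‖u s‖ ^ 2) 0 s := by
    intro s hs
    have h := (hu.2 s hs).norm_sq
    rwa [inner_add_right, inner_smul_right, hF, hG, mul_zero, add_zero, mul_zero] at h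
  have hc : ContinuousOn (fun s => ‖u s‖ ^ 2) (Icc t₀ t₁) := hu.1.norm.pow 2
  have h1 := le_mul_exp_of_hasDerivAt_le (k := 0) hc hd (fun s _ => by simp) ht
  have h2 := le_mul_exp_of_hasDerivAt_le (k := 0) hc.neg (fun s hs => (hd s hs).neg)
    (fun s _ => by simp) ht
  simp only [zero_mul, Real.exp_zero, mul_one, Pi.neg_apply] at h1 h2
  exact (pow_left_inj₀ (norm_nonneg _) (norm_nonneg _) two_ne_zero).1 (by linarith)

/-- Continuous dependence on the initial value, with a rate depending only on a bound for the
control and on the radius of a ball containing the solutions. -/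
theorem exists_dist_le_mul_exp (hF : ContDiff ℝ 1 F) (hG : ContDiff ℝ 1 G) (R M : ℝ) :
    ∃ L : ℝ, 0 ≤ L ∧ ∀ (β : ℝ → ℝ) (t₀ t₁ : ℝ) (u v : ℝ → E3), SolvesOn F G β t₀ t₁ u →
      SolvesOn F G β t₀ t₁ v → (∀ t ∈ Ioo t₀ t₁, |β t| ≤ M) → (∀ t ∈ Ioo t₀ t₁, ‖u t‖ ≤ R) →
      (∀ t ∈ Ioo t₀ t₁, ‖v t‖ ≤ R) → ∀ t ∈ Icc t₀ t₁,
      dist (u t) (v t) ≤ dist (u t₀) (v t₀) * Real.exp (L * (t - t₀)) := by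
  obtain ⟨KF, hKF⟩ := hF.contDiffOn.exists_lipschitzOnWith one_ne_zero
    (convex_closedBall (0 : E3) R) (isCompact_closedBall _ _)
  obtain ⟨KG, hKG⟩ := hG.contDiffOn.exists_lipschitzOnWith one_ne_zero
    (convex_closedBall (0 : E3) R) (isCompact_closedBall _ _)
  refine ⟨KF + |M| * KG, by positivity, fun β t₀ t₁ u v hu hv hβ hur hvr t ht => ?_⟩
  have hd : ∀ s ∈ Ioo t₀ t₁, HasDerivAt (fun s => ‖u s - v s‖ ^ 2)
      (2 * inner ℝ (u s - v s) ((F (u s) + β s • G (u s)) - (F (v s) + β s • G (v s)))) s :=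
    fun s hs => ((hu.2 s hs).sub (hv.2 s hs)).norm_sq
  have hle : ∀ s ∈ Ioo t₀ t₁,
      2 * inner ℝ (u s - v s) ((F (u s) + β s • G (u s)) - (F (v s) + β s • G (v s)))
        ≤ 2 * (KF + |M| * KG) * ‖u s - v s‖ ^ 2 := by
    intro s hs
    have hus : u s ∈ Metric.closedBall (0 : E3) R := by simpa using hur s hs
    have hvs : v s ∈ Metric.closedBall (0 : E3) R := by simpa using hvr s hs
    have h1 : ‖F (u s) - F (v s)‖ ≤ KF * ‖u s - v s‖ := by
      simpa [dist_eq_norm] using hKF.dist_le_mul _ hus _ hvs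
    have h2 : ‖G (u s) - G (v s)‖ ≤ KG * ‖u s - v s‖ := by
      simpa [dist_eq_norm] using hKG.dist_le_mul _ hus _ hvs
    have h3 : ‖(F (u s) + β s • G (u s)) - (F (v s) + β s • G (v s))‖
        ≤ (KF + |M| * KG) * ‖u s - v s‖ := by
      have e : (F (u s) + β s • G (u s)) - (F (v s) + β s • G (v s))
          = (F (u s) - F (v s)) + β s • (G (u s) - G (v s)) := by
        rw [smul_sub]; abel
      rw [e]
      refine (norm_add_le _ _).trans ?_
      rw [norm_smul, Real.norm_eq_abs]
      have h4 : |β s| * ‖G (u s) - G (v s)‖ ≤ |M| * (KG * ‖u s - v s‖) :=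
        mul_le_mul ((hβ s hs).trans (le_abs_self M)) h2 (norm_nonneg _) (abs_nonneg _)
      linarith
    have h5 := (real_inner_le_norm (u s - v s)
      ((F (u s) + β s • G (u s)) - (F (v s) + β s • G (v s)))).trans
      (mul_le_mul_of_nonneg_left h3 (norm_nonneg _))
    linarith
  have h := le_mul_exp_of_hasDerivAt_le ((hu.1.sub hv.1).norm.pow 2) hd hle ht
  have h6 : ‖u t - v t‖ ^ 2 ≤ (‖u t₀ - v t₀‖ * Real.exp ((KF + |M| * KG) * (t - t₀))) ^ 2 := by
    rw [mul_pow, ← Real.exp_nat_mul]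
    refine h.trans_eq ?_
    congr 2
    push_cast
    ring
  rw [dist_eq_norm, dist_eq_norm]
  exact le_of_sq_le_sq h6 (by positivity)

theorem SolvesOn.eqOn (hu : SolvesOn F G β t₀ t₁ u) (hv : SolvesOn F G β t₀ t₁ v)
    (hF : ContDiff ℝ 1 F) (hG : ContDiff ℝ 1 G) (hF' : ∀ x, inner ℝ x (F x) = 0)
    (hG' : ∀ x, inner ℝ x (G x) = 0) {M : ℝ} (hβ : ∀ t ∈ Ioo t₀ t₁, |β t| ≤ M)
    (h0 : u t₀ = v t₀) : EqOn u v (Icc t₀ t₁) := by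
  obtain ⟨L, -, hL⟩ := exists_dist_le_mul_exp hF hG ‖u t₀‖ M
  intro t ht
  have h := hL β t₀ t₁ u v hu hv hβ (fun s hs => (hu.norm_eq hF' hG' (Ioo_subset_Icc_self hs)).le)
    (fun s hs => ((hv.norm_eq hF' hG' (Ioo_subset_Icc_self hs)).trans (by rw [h0])).le) t ht
  rw [h0, dist_self, zero_mul] at h
  exact dist_le_zero.1 h

/-- Multiplication by a cut-off function makes a `C¹` field bounded and Lipschitz. -/
theorem exists_lipschitzWith_cutoff (hF : ContDiff ℝ 1 F) (χ : ContDiffBump (0 : E3)) :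
    ∃ K M : NNReal, LipschitzWith K (fun x => χ x • F x) ∧ ∀ x, ‖χ x • F x‖ ≤ M := by
  have hc : HasCompactSupport (fun x => χ x • F x) := χ.hasCompactSupport.smul_right
  have hd : ContDiff ℝ 1 (fun x => χ x • F x) := χ.contDiff.smul hF
  obtain ⟨K, hK⟩ := ContDiff.lipschitzWith_of_hasCompactSupport hc hd one_ne_zero
  obtain ⟨M, hM⟩ := hd.continuous.bounded_above_of_compact_support hc
  exact ⟨K, M.toNNReal, hK, fun x => (hM x).trans (Real.le_coe_toNNReal M)⟩

/-- Solutions exist on every compact interval. After cutting the fields off outside a ball they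
are bounded and Lipschitz, so that the Picard-Lindelöf theorem applies on the whole interval; as
the norm is preserved, the solution never leaves the ball where the fields are unchanged. -/
theorem exists_solvesOn (hF : ContDiff ℝ 1 F) (hG : ContDiff ℝ 1 G)
    (hF' : ∀ x, inner ℝ x (F x) = 0) (hG' : ∀ x, inner ℝ x (G x) = 0) (h : t₀ ≤ t₁)
    (hβ : ContinuousOn β (Icc t₀ t₁)) (u₀ : E3) :
    ∃ u, SolvesOn F G β t₀ t₁ u ∧ u t₀ = u₀ := by
  let χ : ContDiffBump (0 : E3) := ⟨‖u₀‖ + 1, ‖u₀‖ + 2, by positivity, by linarith⟩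
  obtain ⟨KF, MF, hKF, hMF⟩ := exists_lipschitzWith_cutoff hF χ
  obtain ⟨KG, MG, hKG, hMG⟩ := exists_lipschitzWith_cutoff hG χ
  obtain ⟨M', hM'⟩ := isCompact_Icc.exists_bound_of_continuousOn hβ
  have hM : ∀ t ∈ Icc t₀ t₁, ‖β t‖ ≤ M'.toNNReal := fun t ht =>
    (hM' t ht).trans (Real.le_coe_toNNReal M')
  set M := M'.toNNReal
  have hpl : IsPicardLindelof (fun t x => χ x • F x + β t • (χ x • G x))
      (⟨t₀, left_mem_Icc.2 h⟩ : Icc t₀ t₁) u₀ ((MF + M * MG) * (t₁ - t₀).toNNReal) 0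
      (MF + M * MG) (KF + M * KG) := by
    refine ⟨fun t ht => ?_, fun x _ => ?_, fun t ht x _ => ?_, ?_⟩
    · have h2 : LipschitzWith (M * KG) (fun x => β t • (χ x • G x)) := by
        refine LipschitzWith.of_dist_le_mul fun x y => ?_
        rw [dist_smul₀]
        push_cast
        rw [mul_assoc]
        exact mul_le_mul (hM t ht) (hKG.dist_le_mul x y) dist_nonneg (NNReal.coe_nonneg _)
      exact (hKF.add h2).lipschitzOnWith
    · exact continuousOn_const.add (hβ.smul continuousOn_const)
    · refine (norm_add_le _ _).trans ?_
      rw [norm_smul (β t)]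
      push_cast
      exact add_le_add (hMF x) (mul_le_mul (hM t ht) (hMG x) (norm_nonneg _) (NNReal.coe_nonneg _))
    · push_cast
      rw [Real.coe_toNNReal _ (sub_nonneg.2 h), sub_self, max_eq_left (sub_nonneg.2 h)]
      simp
  obtain ⟨u, hu0, hu⟩ := hpl.exists_eq_forall_mem_Icc_hasDerivWithinAt₀
  have hcut : SolvesOn (fun x => χ x • F x) (fun x => χ x • G x) β t₀ t₁ u :=
    ⟨fun t ht => (hu t ht).continuousWithinAt,
      fun t ht => (hu t (Ioo_subset_Icc_self ht)).hasDerivAt (Icc_mem_nhds ht.1 ht.2)⟩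
  refine ⟨u, ⟨hcut.1, fun t ht => ?_⟩, hu0⟩
  have hn : ‖u t‖ = ‖u₀‖ := by
    have := hcut.norm_eq (fun x => by rw [inner_smul_right, hF', mul_zero])
      (fun x => by rw [inner_smul_right, hG', mul_zero]) (Ioo_subset_Icc_self ht)
    rw [this]
    exact congrArg _ hu0
  have h1 : χ (u t) = 1 := χ.one_of_mem_closedBall (by simp [hn, χ])
  simpa [h1] using hcut.2 t ht

/-- Solutions with an everywhere continuous control exist on `[t₀, ∞)`. -/
theorem exists_solvesOn_Ici (hF : ContDiff ℝ 1 F) (hG : ContDiff ℝ 1 G)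
    (hF' : ∀ x, inner ℝ x (F x) = 0) (hG' : ∀ x, inner ℝ x (G x) = 0) (t₀ : ℝ)
    (hβ : Continuous β) (u₀ : E3) :
    ∃ u, (∀ t₁, SolvesOn F G β t₀ t₁ u) ∧ u t₀ = u₀ := by
  have hex : ∀ n : ℕ, ∃ u, SolvesOn F G β t₀ (t₀ + n) u ∧ u t₀ = u₀ := fun n =>
    exists_solvesOn hF hG hF' hG' (by simp) hβ.continuousOn u₀
  choose w hw hw0 using hex
  have heq : ∀ m n : ℕ, m ≤ n → EqOn (w m) (w n) (Icc t₀ (t₀ + m)) := by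
    intro m n hmn
    obtain ⟨M, hM⟩ := isCompact_Icc.exists_bound_of_continuousOn
      (hβ.continuousOn (s := Icc t₀ (t₀ + m)))
    exact (hw m).eqOn ((hw n).mono (by simpa using hmn)) hF hG hF' hG'
      (fun t ht => hM t (Ioo_subset_Icc_self ht)) (by rw [hw0, hw0])
  let u : ℝ → E3 := fun t => w ⌈t - t₀⌉₊ t
  have hu : ∀ n : ℕ, EqOn u (w n) (Icc t₀ (t₀ + n)) := by
    intro n t ht
    have h1 : ⌈t - t₀⌉₊ ≤ n := Nat.ceil_le.2 (by linarith [ht.2])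
    exact heq _ n h1 ⟨ht.1, by linarith [Nat.le_ceil (t - t₀)]⟩
  refine ⟨u, fun t₁ => ?_, by simp only [u]; exact hw0 _⟩
  obtain ⟨n, hn⟩ := exists_nat_ge (t₁ - t₀)
  refine SolvesOn.mono (t₂ := t₀ + n) ⟨(hw n).1.congr (hu n), fun t ht => ?_⟩ (by linarith)
  have := (hw n).2 t ht
  rw [← hu n (Ioo_subset_Icc_self ht)] at this
  exact this.congr_of_eventuallyEq ((hu n).eventuallyEq_of_mem (Icc_mem_nhds ht.1 ht.2))

/-! ### The Landau-Lifshitz-Slonczewski field -/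

theorem abs_mul_le_of_le {x y X Y : ℝ} (hx : |x| ≤ X) (hy : |y| ≤ Y) : |x * y| ≤ X * Y := by
  rw [abs_mul]
  exact mul_le_mul hx hy (abs_nonneg _) ((abs_nonneg _).trans hx)

theorem E3_norm_sq (u : E3) : ‖u‖ ^ 2 = u 0 ^ 2 + u 1 ^ 2 + u 2 ^ 2 := by
  rw [EuclideanSpace.norm_sq_eq, Fin.sum_univ_three]
  simp

theorem E3_abs_le_norm (u : E3) (i : Fin 3) : |u i| ≤ ‖u‖ := by
  simpa using PiLp.norm_apply_le u i

theorem E3_hasDerivAt_apply {u : ℝ → E3} {u' : E3} {t : ℝ} (h : HasDerivAt u u' t) (i : Fin 3) :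
    HasDerivAt (fun s => u s i) (u' i) t :=
  (EuclideanSpace.proj (𝕜 := ℝ) i).hasFDerivAt.comp_hasDerivAt t h

theorem E3_continuousOn_apply {u : ℝ → E3} {s : Set ℝ} (h : ContinuousOn u s) (i : Fin 3) :
    ContinuousOn (fun s => u s i) s :=
  (EuclideanSpace.proj (𝕜 := ℝ) (ι := Fin 3) i).continuous.comp_continuousOn h

theorem E3_tendsto {α : Type*} {l : Filter α} {u : α → E3} {x y z : ℝ}
    (hx : Tendsto (fun t => u t 0) l (𝓝 x)) (hy : Tendsto (fun t => u t 1) l (𝓝 y))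
    (hz : Tendsto (fun t => u t 2) l (𝓝 z)) : Tendsto u l (𝓝 !₂[x, y, z]) := by
  have h : Tendsto (fun t => (fun i => u t i : Fin 3 → ℝ)) l (𝓝 ![x, y, z]) := by
    refine tendsto_pi_nhds.2 fun i => ?_
    fin_cases i
    · exact hx
    · exact hy
    · exact hz
  exact ((PiLp.continuous_toLp 2 (fun _ : Fin 3 => ℝ)).tendsto _).comp h

namespace Params

variable (p : Params) (lam : ℝ)

/-- The field multiplying the current: `p.field lam β u = p.field lam 0 u + β • p.steer lam u`. -/
def steer (u : E3) : E3 :=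
  !₂[lam * u 0 * u 2, lam * u 1 * u 2, -(lam * (u 0 ^ 2 + u 1 ^ 2))]

theorem field_eq (β : ℝ) (u : E3) : p.field lam β u = p.field lam 0 u + β • steer lam u := by
  ext i
  fin_cases i <;> simp [field, steer] <;> ring

theorem contDiff_field (β : ℝ) : ContDiff ℝ 1 (p.field lam β) := by
  have h : ∀ i : Fin 3, ContDiff ℝ 1 (fun u : E3 => u i) := fun i =>
    (EuclideanSpace.proj (𝕜 := ℝ) (ι := Fin 3) i).contDiff
  have h0 := h 0
  have h1 := h 1
  have h2 := h 2
  rw [contDiff_euclidean]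
  intro i
  fin_cases i <;> simp only [field, Fin.zero_eta, Fin.mk_one, Fin.reduceFinMk, PiLp.toLp_apply,
    Matrix.cons_val] <;> fun_prop

theorem contDiff_steer : ContDiff ℝ 1 (steer lam) := by
  have h : ∀ i : Fin 3, ContDiff ℝ 1 (fun u : E3 => u i) := fun i =>
    (EuclideanSpace.proj (𝕜 := ℝ) (ι := Fin 3) i).contDiff
  have h0 := h 0
  have h1 := h 1
  have h2 := h 2
  rw [contDiff_euclidean]
  intro i
  fin_cases i <;> simp only [steer, Fin.zero_eta, Fin.mk_one, Fin.reduceFinMk, PiLp.toLp_apply,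
    Matrix.cons_val] <;> fun_prop

theorem inner_field (β : ℝ) (u : E3) : inner ℝ u (p.field lam β u) = 0 := by
  simp [PiLp.inner_apply, Fin.sum_univ_three, field, D32, D31, D2]
  ring

theorem inner_steer (u : E3) : inner ℝ u (steer lam u) = 0 := by
  simp [PiLp.inner_apply, Fin.sum_univ_three, steer]
  ring

/-- `u` solves the scaled system with control `β` on the compact interval `[t₀, t₁]`. -/
abbrev Solves (β : ℝ → ℝ) (t₀ t₁ : ℝ) (u : ℝ → E3) : Prop :=
  SolvesOn (p.field lam 0) (steer lam) β t₀ t₁ u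

variable {p lam} {β : ℝ → ℝ} {t₀ t₁ T : ℝ} {u : ℝ → E3}

theorem Solves.norm_eq (hu : p.Solves lam β t₀ t₁ u) {t : ℝ} (ht : t ∈ Icc t₀ t₁) :
    ‖u t‖ = ‖u t₀‖ :=
  SolvesOn.norm_eq hu (p.inner_field lam 0) (inner_steer lam) ht

theorem Solves.hasDerivAt (hu : p.Solves lam β t₀ t₁ u) {t : ℝ} (ht : t ∈ Ioo t₀ t₁) :
    HasDerivAt u (p.field lam (β t) (u t)) t := by
  rw [field_eq]
  exact hu.2 t ht

theorem IsSolution.solves {S : Set ℝ} {s₀ : ℝ} (hu : p.IsSolution lam β s₀ S u) (h : s₀ ≤ t₀)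
    (hS : ∀ t ∈ Ioo t₀ t₁, t ∉ S) : p.Solves lam β t₀ t₁ u :=
  ⟨hu.1.mono fun _ ht => h.trans ht.1, fun t ht => by
    rw [← field_eq]
    exact hu.2 t (h.trans_lt ht.1) (hS t ht)⟩

/-- Three successive solutions join to a solution on `[t₀, ∞)` with switching times `0` and `T`. -/
theorem exists_isSolution_of_pieces {u₁ u₂ u₃ : ℝ → E3} (h0 : t₀ < 0) (hT : 0 < T)
    (h₁ : p.Solves lam β t₀ 0 u₁) (h₂ : p.Solves lam β 0 T u₂)
    (h₃ : ∀ t₁, p.Solves lam β T t₁ u₃) (h₁₂ : u₂ 0 = u₁ 0) (h₂₃ : u₃ T = u₂ T) :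
    ∃ u, p.IsSolution lam β t₀ {0, T} u ∧ u t₀ = u₁ t₀ := by
  let u : ℝ → E3 := fun t => if t ≤ 0 then u₁ t else if t ≤ T then u₂ t else u₃ t
  have e₁ : EqOn u u₁ (Icc t₀ 0) := fun t ht => if_pos ht.2
  have e₂ : EqOn u u₂ (Icc 0 T) := by
    intro t ht
    rcases ht.1.eq_or_lt with h | h
    · subst h
      simp only [u, le_refl, if_true, h₁₂]
    · simp only [u, not_le.2 h, ht.2, if_true, if_false]
  have e₃ : EqOn u u₃ (Ici T) := by
    intro t ht
    have h' : ¬ t ≤ 0 := not_le.2 (hT.trans_le ht)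
    rcases (mem_Ici.1 ht).eq_or_lt with h | h
    · subst h
      simp only [u, h', le_refl, if_true, if_false, h₂₃]
    · simp only [u, h', not_le.2 h, if_false]
  have c₃ : ContinuousOn u₃ (Ici T) := by
    intro t ht
    refine ((h₃ (t + 1)).1 t ⟨ht, by linarith⟩).mono_of_mem_nhdsWithin ?_
    filter_upwards [self_mem_nhdsWithin, mem_nhdsWithin_of_mem_nhds (Iio_mem_nhds (lt_add_one t))]
      with s hs hs' using ⟨hs, le_of_lt hs'⟩
  refine ⟨u, ⟨?_, ?_⟩, e₁ (left_mem_Icc.2 h0.le)⟩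
  · have hcover : Ici t₀ = Icc t₀ 0 ∪ (Icc 0 T ∪ Ici T) := by
      rw [Icc_union_Ici_eq_Ici hT.le, Icc_union_Ici_eq_Ici h0.le]
    rw [hcover]
    exact (h₁.1.congr e₁).union_of_isClosed
      ((h₂.1.congr e₂).union_of_isClosed (c₃.congr e₃) isClosed_Icc isClosed_Ici)
      isClosed_Icc (isClosed_Icc.union isClosed_Ici)
  · intro t ht htS
    have htS : t ≠ 0 ∧ t ≠ T := by simpa using htS
    rcases lt_or_gt_of_ne htS.1 with h | h
    · have hd := Solves.hasDerivAt h₁ ⟨ht, h⟩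
      rw [← e₁ ⟨ht.le, h.le⟩] at hd
      exact hd.congr_of_eventuallyEq (e₁.eventuallyEq_of_mem (Icc_mem_nhds ht h))
    rcases lt_or_gt_of_ne htS.2 with h' | h'
    · have hd := Solves.hasDerivAt h₂ ⟨h, h'⟩
      rw [← e₂ ⟨h.le, h'.le⟩] at hd
      exact hd.congr_of_eventuallyEq (e₂.eventuallyEq_of_mem (Icc_mem_nhds h h'))
    · have hd := Solves.hasDerivAt (h₃ (t + 1)) ⟨h', lt_add_one t⟩
      rw [← e₃ (mem_Ici.2 h'.le)] at hd
      exact hd.congr_of_eventuallyEq (e₃.eventuallyEq_of_mem (Ici_mem_nhds h'))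

variable {a b : ℝ}

theorem D32_eq (p : Params) (lam : ℝ) : p.D32 lam = p.D31 - lam * p.Dt21 := by
  simp only [D32, D31, D2]
  ring

theorem abs_ht2_le (hp : p ∈ paramSet a b) (ha : 0 < a) : |p.ht2| ≤ b := by
  obtain ⟨-, -, hd, -, hΩ⟩ := hp
  rw [ht2, abs_neg, abs_of_nonneg (mul_nonneg (ha.le.trans hd.1) hΩ.1.le)]
  nlinarith [hd.1, hd.2, hΩ.1, hΩ.2]

theorem D32_mem (hp : p ∈ paramSet a b) (ha : 0 < a) (hl : 0 < lam) (hlb : lam * b ≤ a / 2) :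
    p.D32 lam ∈ Icc (a / 2) b := by
  obtain ⟨-, hA, hd, -, -⟩ := hp
  have h1 : lam * p.Dt21 ≤ lam * b := mul_le_mul_of_nonneg_left hd.2 hl.le
  have h2 : 0 < lam * p.Dt21 := mul_pos hl (ha.trans_le hd.1)
  rw [D32_eq]
  constructor <;> linarith [hA.1, hA.2]

/-! ### Escape: the constant current -/

/-- On the unit sphere near the equator, a sufficiently large constant current pushes the third
component down at a rate at least `lam`. -/
theorem field_two_le_neg (hp : p ∈ paramSet a b) (ha : 0 < a) (hl : 0 < lam) (hl1 : lam ≤ 1)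
    (hlb : lam * b ≤ a / 2) {v : E3} (hv : ‖v‖ = 1) (hz : 2 * v 2 ^ 2 ≤ 1) :
    p.field lam (4 * b + 4 * b ^ 2 + 2) v 2 ≤ -lam := by
  have hh := abs_ht2_le hp ha
  have hB := D32_mem hp ha hl hlb
  obtain ⟨-, hA, hd, hα, -⟩ := hp
  have hb : 0 ≤ b := by linarith [hd.1, hd.2]
  have hn := E3_norm_sq v
  rw [hv] at hn
  have hx := (E3_abs_le_norm v 0).trans_eq hv
  have hy := (E3_abs_le_norm v 1).trans_eq hv
  have hz1 := (E3_abs_le_norm v 2).trans_eq hv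
  have hd' : |p.Dt21| ≤ b := by rw [abs_of_nonneg (by linarith [hd.1])]; exact hd.2
  have hα' : |p.αt| ≤ b := by rw [abs_of_nonneg hα.1.le]; exact hα.2
  have hl' : |lam| ≤ 1 := by rw [abs_of_pos hl]; exact hl1
  have hq : |p.D32 lam * v 1 ^ 2 + p.D31 * v 0 ^ 2| ≤ b := by
    rw [abs_of_nonneg (by nlinarith [hB.1, hA.1, sq_nonneg (v 0), sq_nonneg (v 1)])]
    nlinarith [mul_le_mul_of_nonneg_right hB.2 (sq_nonneg (v 1)),
      mul_le_mul_of_nonneg_right hA.2 (sq_nonneg (v 0)), sq_nonneg (v 2)]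
  have e1 := (abs_le.1 (abs_mul_le_of_le hh hx)).1
  have e2 := (abs_le.1 (abs_mul_le_of_le (abs_mul_le_of_le hx hy) hd')).2
  have e3 := (abs_le.1 (abs_mul_le_of_le (abs_mul_le_of_le hα' hz1) hq)).1
  have e4 := (abs_le.1 (abs_mul_le_of_le (abs_mul_le_of_le
    (abs_mul_le_of_le (abs_mul_le_of_le hα' hh) hl') hy) hz1)).1
  have e5 : (v 0 ^ 2 + v 1 ^ 2) * (4 * b + 4 * b ^ 2 + 2) ≥ 1 / 2 * (4 * b + 4 * b ^ 2 + 2) :=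
    mul_le_mul_of_nonneg_right (by linarith) (by positivity)
  have e : p.field lam (4 * b + 4 * b ^ 2 + 2) v 2 = lam * (-(p.ht2 * v 0) + v 0 * v 1 * p.Dt21
      - (v 0 ^ 2 + v 1 ^ 2) * (4 * b + 4 * b ^ 2 + 2)
      - p.αt * v 2 * (p.D32 lam * v 1 ^ 2 + p.D31 * v 0 ^ 2)
      - p.αt * p.ht2 * lam * v 1 * v 2) := by
    simp only [field, PiLp.toLp_apply, Matrix.cons_val]
    ring
  rw [e, ← mul_neg_one lam]
  exact mul_le_mul_of_nonneg_left (by linarith) hl.le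

/-- Under the constant current a solution starting on the equator reaches the latitude `-K`. -/
theorem Solves.exists_reach (hp : p ∈ paramSet a b) (ha : 0 < a) (hl : 0 < lam) (hl1 : lam ≤ 1)
    (hlb : lam * b ≤ a / 2) {K : ℝ} (hK : 0 < K) (hK2 : 2 * K ^ 2 ≤ 1)
    (hu : p.Solves lam (fun _ => 4 * b + 4 * b ^ 2 + 2) 0 (3 * K / lam) u) (hu1 : ‖u 0‖ = 1)
    (hu2 : u 0 2 = 0) : ∃ T ∈ Ioo 0 (3 * K / lam), u T 2 = -K := by
  set T₁ := 3 * K / lam with hT₁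
  have hT₁0 : 0 < T₁ := by positivity
  have hlT : lam * T₁ = 3 * K := by rw [hT₁]; field_simp
  have hc := E3_continuousOn_apply hu.1 2
  by_contra hcon
  push Not at hcon
  have hgt : ∀ t ∈ Ico 0 T₁, -K < u t 2 := by
    intro t ht
    by_contra hle
    push Not at hle
    obtain ⟨s, hs, hs'⟩ := intermediate_value_Icc' ht.1
      (hc.mono (Icc_subset_Icc_right ht.2.le)) ⟨hle, by rw [hu2]; linarith⟩
    have hs0 : s ≠ 0 := by
      rintro rfl
      simp only [hu2] at hs'
      linarith
    exact hcon s ⟨lt_of_le_of_ne hs.1 hs0.symm, hs.2.trans_lt ht.2⟩ hs'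
  -- The comparison with a line of slope `-lam / 2` starts at a small positive time, since the
  -- derivative is known at interior times only.
  obtain ⟨ε, hε, hεT, hεK, hεz⟩ : ∃ ε, 0 < ε ∧ ε < T₁ ∧ ε < K / (4 * lam) ∧ u ε 2 < K / 8 := by
    have h1 : Tendsto (fun t => u t 2) (𝓝[>] 0) (𝓝 0) := by
      have h := hc 0 (left_mem_Icc.2 hT₁0.le)
      rw [ContinuousWithinAt, hu2] at h
      exact h.mono_left (nhdsWithin_le_of_mem
        (mem_of_superset (Ioc_mem_nhdsGT hT₁0) Ioc_subset_Icc_self))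
    have h2 : (0 : ℝ) < K / 8 := by positivity
    have h3 : 0 < min T₁ (K / (4 * lam)) := lt_min hT₁0 (by positivity)
    obtain ⟨ε, h4, h5⟩ := ((h1.eventually (Iio_mem_nhds h2)).and (Ioo_mem_nhdsGT h3)).exists
    exact ⟨ε, h5.1, h5.2.trans_le (min_le_left _ _), h5.2.trans_le (min_le_right _ _), h4⟩
  have hεK' : lam * ε < K / 4 := by
    have h := mul_lt_mul_of_pos_left hεK hl
    have e : lam * (K / (4 * lam)) = K / 4 := by field_simp
    linarith
  have hfence := image_le_of_deriv_right_lt_deriv_boundary (f := fun t => u t 2)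
    (f' := fun t => p.field lam (4 * b + 4 * b ^ 2 + 2) (u t) 2) (a := ε) (b := T₁)
    (B := fun t => K / 8 + (t - ε) * (-(lam / 2))) (B' := fun _ => -(lam / 2))
    (hc.mono (Icc_subset_Icc_left hε.le))
    (fun t ht => (E3_hasDerivAt_apply
      (Solves.hasDerivAt hu ⟨hε.trans_le ht.1, ht.2⟩) 2).hasDerivWithinAt)
    (by simpa using hεz.le)
    (fun t => by
      simpa using (((hasDerivAt_id' t).sub_const ε).mul_const (-(lam / 2))).const_add (K / 8))
    (fun t ht heq => by
      have ht0 : t ∈ Ico 0 T₁ := ⟨hε.le.trans ht.1, ht.2⟩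
      have h1 := hgt t ht0
      have h2 : u t 2 ≤ K / 8 := by
        simp only at heq
        nlinarith [mul_nonneg hl.le (sub_nonneg.2 ht.1)]
      have h3 : u t 2 ^ 2 ≤ K ^ 2 := sq_le_sq' h1.le (by linarith)
      have h4 := field_two_le_neg hp ha hl hl1 hlb (v := u t)
        ((Solves.norm_eq hu ⟨ht0.1, ht0.2.le⟩).trans hu1) (by linarith)
      linarith)
  have hend : u T₁ 2 < -K := by
    have h := hfence (right_mem_Icc.2 hεT.le)
    simp only at h
    nlinarith
  obtain ⟨s, hs, hs'⟩ := intermediate_value_Icc' hT₁0.le hc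
    ⟨hend.le, by rw [hu2]; linarith⟩
  have hs0 : s ≠ 0 := by
    rintro rfl
    simp only [hu2] at hs'
    linarith
  have hsT : s ≠ T₁ := by
    rintro rfl
    exact hend.ne hs'
  exact hcon s ⟨lt_of_le_of_ne hs.1 hs0.symm, lt_of_le_of_ne hs.2 hsT⟩ hs'

/-! ### Relaxation: the uncontrolled flow near the target -/

variable (p lam) in
/-- Twice the micromagnetic energy, up to a function of the norm: the sum of the weighted squared
distances to the equator and to the plane `u₂ = -Ω`. -/
def energy (v : E3) : ℝ := p.D31 * v 2 ^ 2 + lam * p.Dt21 * (v 1 + p.Ω) ^ 2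

variable (p lam) in
/-- The rate at which damping dissipates the energy; the conservative part of the field does not
contribute. -/
def dissipation (v : E3) : ℝ :=
  2 * (p.αt * lam) * (v 0 ^ 2 * (p.D31 ^ 2 * v 2 ^ 2 + (lam * p.Dt21) ^ 2 * (v 1 + p.Ω) ^ 2)
    + v 2 ^ 2 * (p.D31 * v 1 - lam * p.Dt21 * (v 1 + p.Ω)) ^ 2)

theorem continuous_energy : Continuous (p.energy lam) := by
  unfold energy
  fun_prop

theorem Solves.hasDerivAt_energy (hu : p.Solves lam (fun _ => 0) t₀ t₁ u) {t : ℝ}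
    (ht : t ∈ Ioo t₀ t₁) :
    HasDerivAt (fun t => p.energy lam (u t)) (-p.dissipation lam (u t)) t := by
  have hd := Solves.hasDerivAt hu ht
  have h1 := ((E3_hasDerivAt_apply hd 1).add_const p.Ω).pow 2
  have h2 := (E3_hasDerivAt_apply hd 2).pow 2
  refine ((h2.const_mul p.D31).add (h1.const_mul (lam * p.Dt21))).congr_deriv ?_
  simp only [field, PiLp.toLp_apply, Matrix.cons_val, dissipation, D32_eq, ht2]
  ring

/-- Below a quarter of the energy barrier between the two equilibria, the first component
of points of a sphere of radius near `1` is bounded away from zero. -/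
theorem half_le_sq_of_energy_le (hp : p ∈ paramSet a b) (ha : 0 < a) (ha1 : a < 1) (hl : 0 < lam)
    (hlb : lam * b ≤ a / 2) {v : E3} (hR : 1 - a / 8 ≤ ‖v‖ ^ 2)
    (hE : p.energy lam v ≤ lam * p.Dt21 * (a / 2) ^ 2) : a / 2 ≤ v 0 ^ 2 := by
  obtain ⟨-, hA, hd, hα, hΩ⟩ := hp
  have hld : 0 < lam * p.Dt21 := mul_pos hl (ha.trans_le hd.1)
  have hldb : lam * p.Dt21 ≤ a / 2 := (mul_le_mul_of_nonneg_left hd.2 hl.le).trans hlb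
  rw [E3_norm_sq] at hR
  rw [energy] at hE
  have hA0 : 0 < p.D31 := ha.trans_le hA.1
  have hq : (v 1 + p.Ω) ^ 2 ≤ (a / 2) ^ 2 := by
    refine le_of_mul_le_mul_left ?_ hld
    nlinarith [mul_nonneg hA0.le (sq_nonneg (v 2))]
  have hz : v 2 ^ 2 ≤ a ^ 2 / 8 := by
    have h1 : a * v 2 ^ 2 ≤ a * (a ^ 2 / 8) := by
      nlinarith [mul_le_mul_of_nonneg_right hA.1 (sq_nonneg (v 2)),
        mul_nonneg hld.le (sq_nonneg (v 1 + p.Ω)),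
        mul_le_mul_of_nonneg_right hldb (sq_nonneg (a / 2))]
    exact le_of_mul_le_mul_left h1 ha
  have hq' := abs_le.1 (abs_le_of_sq_le_sq hq (by positivity))
  have hy : v 1 ^ 2 ≤ (1 - a / 2) ^ 2 := sq_le_sq' (by linarith [hq'.1, hΩ.2])
    (by linarith [hq'.2, hΩ.1])
  nlinarith

/-- The uncontrolled flow carries every point below a quarter of the energy barrier, on the side
of `s⁺`, to the equilibrium of its own sphere. -/
theorem Solves.tendsto_equilibrium (hp : p ∈ paramSet a b) (ha : 0 < a) (ha1 : a < 1)
    (hl : 0 < lam) (hlb : lam * b ≤ a / 2) (hu : ∀ t₁, p.Solves lam (fun _ => 0) T t₁ u)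
    (hR : 1 - a / 8 ≤ ‖u T‖ ^ 2) (hx : 0 < u T 0)
    (hE : p.energy lam (u T) ≤ lam * p.Dt21 * (a / 2) ^ 2) :
    Tendsto u atTop (𝓝 !₂[√(‖u T‖ ^ 2 - p.Ω ^ 2), -p.Ω, 0]) := by
  have hp' := hp
  obtain ⟨-, hA, hd, hα, hΩ⟩ := hp
  have hA0 : 0 < p.D31 := ha.trans_le hA.1
  have hld : 0 < lam * p.Dt21 := mul_pos hl (ha.trans_le hd.1)
  have hαl : 0 < p.αt * lam := mul_pos hα.1 hl
  have hldA : lam * p.Dt21 ≤ p.D31 := by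
    have := mul_le_mul_of_nonneg_left hd.2 hl.le
    linarith [hA.1]
  have hn : ∀ t ∈ Ici T, ‖u t‖ = ‖u T‖ := fun t ht => Solves.norm_eq (hu t) (right_mem_Icc.2 ht)
  have hcE : ∀ t₁, ContinuousOn (fun t => p.energy lam (u t)) (Icc T t₁) := fun t₁ =>
    continuous_energy.comp_continuousOn (hu t₁).1
  have hEle : ∀ t ∈ Ici T, p.energy lam (u t) ≤ p.energy lam (u T) := by
    intro t ht
    have h := le_mul_exp_of_hasDerivAt_le (k := 0) (hcE t)
      (fun s hs => Solves.hasDerivAt_energy (hu t) hs)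
      (fun s _ => by
        have : 0 ≤ p.dissipation lam (u s) := by unfold dissipation; positivity
        linarith) (right_mem_Icc.2 ht)
    simpa using h
  have hx2 : ∀ t ∈ Ici T, a / 2 ≤ u t 0 ^ 2 := fun t ht =>
    half_le_sq_of_energy_le hp' ha ha1 hl hlb (by rw [hn t ht]; exact hR) ((hEle t ht).trans hE)
  have hxpos : ∀ t ∈ Ici T, 0 < u t 0 := by
    intro t ht
    by_contra hle
    obtain ⟨s, hs, hs'⟩ := intermediate_value_Icc' (mem_Ici.1 ht)
      (E3_continuousOn_apply (hu t).1 0) ⟨not_lt.1 hle, hx.le⟩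
    have h := hx2 s hs.1
    simp only at hs'
    rw [hs'] at h
    norm_num at h
    linarith
  set k := p.αt * lam * a * (lam * p.Dt21) with hk
  have hk0 : 0 < k := by positivity
  have hdecay : ∀ t ∈ Ici T, p.energy lam (u t) ≤
      p.energy lam (u T) * Real.exp (-k * (t - T)) := by
    intro t ht
    refine le_mul_exp_of_hasDerivAt_le (hcE t)
      (fun s hs => Solves.hasDerivAt_energy (hu t) hs) (fun s hs => ?_) (right_mem_Icc.2 ht)
    have h1 := hx2 s (le_of_lt hs.1)
    have h2 : lam * p.Dt21 * p.energy lam (u s) ≤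
        p.D31 ^ 2 * u s 2 ^ 2 + (lam * p.Dt21) ^ 2 * (u s 1 + p.Ω) ^ 2 := by
      rw [energy]
      nlinarith [mul_le_mul_of_nonneg_right hldA (mul_nonneg hA0.le (sq_nonneg (u s 2)))]
    have h0 : 0 ≤ lam * p.Dt21 * p.energy lam (u s) := by unfold energy; positivity
    have h3 : a / 2 * (lam * p.Dt21 * p.energy lam (u s)) ≤
        u s 0 ^ 2 * (p.D31 ^ 2 * u s 2 ^ 2 + (lam * p.Dt21) ^ 2 * (u s 1 + p.Ω) ^ 2) :=
      mul_le_mul h1 h2 h0 (sq_nonneg _)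
    have h4 : 0 ≤ u s 2 ^ 2 * (p.D31 * u s 1 - lam * p.Dt21 * (u s 1 + p.Ω)) ^ 2 := by positivity
    have h5 := mul_le_mul_of_nonneg_left (add_le_add h3 h4) (mul_pos two_pos hαl).le
    rw [dissipation, hk]
    linarith
  have hE0 : Tendsto (fun t => p.energy lam (u t)) atTop (𝓝 0) := by
    have hexp : Tendsto (fun t => p.energy lam (u T) * Real.exp (-k * (t - T))) atTop (𝓝 0) := by
      rw [← mul_zero (p.energy lam (u T))]
      refine (Real.tendsto_exp_atBot.comp ?_).const_mul _
      exact (tendsto_atTop_add_const_right _ (-T) tendsto_id).const_mul_atTop_of_neg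
        (neg_lt_zero.2 hk0)
    refine squeeze_zero' (Eventually.of_forall fun t => ?_)
      ((eventually_ge_atTop T).mono hdecay) hexp
    unfold energy
    positivity
  have hz2 : Tendsto (fun t => u t 2 ^ 2) atTop (𝓝 0) := by
    refine squeeze_zero (fun t => sq_nonneg _) (fun t => ?_)
      (by simpa only [mul_zero] using hE0.const_mul p.D31⁻¹)
    rw [inv_mul_eq_div, le_div_iff₀ hA0, energy]
    nlinarith [mul_nonneg hld.le (sq_nonneg (u t 1 + p.Ω))]
  have hq2 : Tendsto (fun t => (u t 1 + p.Ω) ^ 2) atTop (𝓝 0) := by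
    refine squeeze_zero (fun t => sq_nonneg _) (fun t => ?_)
      (by simpa only [mul_zero] using hE0.const_mul (lam * p.Dt21)⁻¹)
    rw [inv_mul_eq_div, le_div_iff₀ hld, energy]
    nlinarith [mul_nonneg hA0.le (sq_nonneg (u t 2))]
  have hsq : ∀ g : ℝ → ℝ, Tendsto (fun t => g t ^ 2) atTop (𝓝 0) → Tendsto g atTop (𝓝 0) := by
    intro g hg
    have h := (Real.continuous_sqrt.tendsto 0).comp hg
    rw [Real.sqrt_zero] at h
    refine (tendsto_zero_iff_abs_tendsto_zero _).2 (h.congr fun t => ?_)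
    simp [Real.sqrt_sq_eq_abs]
  have hz := hsq _ hz2
  have hy : Tendsto (fun t => u t 1) atTop (𝓝 (-p.Ω)) := by
    simpa using (hsq _ hq2).sub_const p.Ω
  refine E3_tendsto ?_ hy hz
  have hlim : Tendsto (fun t => √(‖u T‖ ^ 2 - u t 1 ^ 2 - u t 2 ^ 2)) atTop
      (𝓝 √(‖u T‖ ^ 2 - p.Ω ^ 2)) := by
    have h := ((tendsto_const_nhds (x := ‖u T‖ ^ 2)).sub (hy.pow 2)).sub hz2
    rw [neg_sq, sub_zero] at h
    exact (Real.continuous_sqrt.tendsto _).comp h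
  refine hlim.congr' ((eventually_ge_atTop T).mono fun t ht => ?_)
  have h1 := E3_norm_sq (u t)
  rw [hn t ht] at h1
  rw [show ‖u T‖ ^ 2 - u t 1 ^ 2 - u t 2 ^ 2 = u t 0 ^ 2 by linarith]
  exact Real.sqrt_sq (hxpos t ht).le

end Params

namespace Params

variable {p : Params} {lam a b K κ w₁ w₂ : ℝ}

/-! ### The approximate latitudinal motion -/

theorem abs_add_le_of_le {x y X Y : ℝ} (hx : |x| ≤ X) (hy : |y| ≤ Y) : |x + y| ≤ X + Y :=
  (abs_add_le x y).trans (add_le_add hx hy)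

theorem abs_sub_le_of_le {x y X Y : ℝ} (hx : |x| ≤ X) (hy : |y| ≤ Y) : |x - y| ≤ X + Y :=
  (abs_sub x y).trans (add_le_add hx hy)

theorem σ_sq (hp : p ∈ paramSet a b) (ha : 0 < a) (hl : 0 < lam) (hlb : lam * b ≤ a / 2) :
    p.D31 * p.σ lam ^ 2 = p.D32 lam := by
  have hB := D32_mem hp ha hl hlb
  have hA : 0 < p.D31 := ha.trans_le hp.2.1.1
  rw [σ, Real.sq_sqrt (div_nonneg (by linarith [hB.1]) hA.le)]
  field_simp

theorem σ_mem (hp : p ∈ paramSet a b) (ha : 0 < a) (hl : 0 < lam) (hlb : lam * b ≤ a / 2) :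
    p.σ lam ∈ Icc (1 / 2) 1 ∧ 1 / 2 ≤ p.σ lam ^ 2 ∧ 1 - p.σ lam ≤ lam * (b / a) := by
  have hs := σ_sq hp ha hl hlb
  have h0 : 0 ≤ p.σ lam := Real.sqrt_nonneg _
  obtain ⟨-, hA, hd, -, -⟩ := hp
  have hA0 : 0 < p.D31 := ha.trans_le hA.1
  have hld : 0 < lam * p.Dt21 := mul_pos hl (ha.trans_le hd.1)
  have hldb : lam * p.Dt21 ≤ lam * b := mul_le_mul_of_nonneg_left hd.2 hl.le
  rw [D32_eq] at hs
  have h1 : p.σ lam ^ 2 ≤ 1 := le_of_mul_le_mul_left (by linarith) hA0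
  have h2 : 1 / 2 ≤ p.σ lam ^ 2 := le_of_mul_le_mul_left (by linarith [hA.1]) hA0
  have h3 : p.σ lam ≤ 1 := by nlinarith
  refine ⟨⟨by nlinarith, h3⟩, h2, ?_⟩
  have h4 : a * (1 - p.σ lam ^ 2) ≤ lam * b := by
    nlinarith [mul_le_mul_of_nonneg_right hA.1 (sub_nonneg.2 h1)]
  have h5 : 1 - p.σ lam ^ 2 ≤ lam * (b / a) := by
    rw [← mul_div_assoc, le_div_iff₀ ha]
    linarith
  nlinarith

theorem freq_eq (hp : p ∈ paramSet a b) (ha : 0 < a) (hl : 0 < lam) (hlb : lam * b ≤ a / 2)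
    (K : ℝ) : p.freq lam K = K * (p.D31 * p.σ lam) := by
  have hA : 0 < p.D31 := ha.trans_le hp.2.1.1
  have h0 : 0 ≤ p.σ lam := Real.sqrt_nonneg _
  rw [freq, ← σ_sq hp ha hl hlb,
    show p.D31 * p.σ lam ^ 2 * p.D31 = (p.D31 * p.σ lam) ^ 2 by ring,
    Real.sqrt_sq (mul_nonneg hA.le h0)]

theorem abs_prefactor_le (hp : p ∈ paramSet a b) (ha : 0 < a) (hl : 0 < lam)
    (hlb : lam * b ≤ a / 2) (hK : 0 < K) (hK2 : 2 * K ^ 2 ≤ 1) :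
    |(p.freq lam K)⁻¹ * K * (1 - K ^ 2)⁻¹| ≤ 4 / a := by
  have hσ := (σ_mem hp ha hl hlb).1
  have hA := hp.2.1
  have h1 : a / 2 ≤ p.D31 * p.σ lam := by nlinarith [hσ.1, hA.1]
  have h2 : (p.freq lam K)⁻¹ * K = (p.D31 * p.σ lam)⁻¹ := by
    rw [freq_eq hp ha hl hlb, mul_inv, mul_comm, ← mul_assoc, mul_inv_cancel₀ hK.ne', one_mul]
  have h3 : (p.D31 * p.σ lam)⁻¹ ≤ (a / 2)⁻¹ := inv_anti₀ (by positivity) h1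
  have h4 : (1 - K ^ 2)⁻¹ ≤ (1 / 2)⁻¹ := inv_anti₀ (by norm_num) (by linarith)
  have h5 : 0 ≤ (p.D31 * p.σ lam)⁻¹ := inv_nonneg.2 ((by positivity : 0 ≤ a / 2).trans h1)
  have h6 : 0 ≤ (1 - K ^ 2)⁻¹ := inv_nonneg.2 (by linarith)
  rw [h2, abs_of_nonneg (mul_nonneg h5 h6)]
  calc _ ≤ (a / 2)⁻¹ * (1 / 2)⁻¹ := mul_le_mul h3 h4 h6 (by positivity)
    _ = 4 / a := by field_simp; norm_num

theorem abs_wOne_le (hp : p ∈ paramSet a b) (ha : 0 < a) (hl : 0 < lam)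
    (hlb : lam * b ≤ a / 2) (hK : 0 < K) (hK2 : 2 * K ^ 2 ≤ 1) {Xa Xb : ℝ} (hXa : |Xa| ≤ 2)
    (hXb : |Xb| ≤ 2) (t : ℝ) :
    |p.wOne₁ lam K Xa Xb t| ≤ 700 * b / a ∧ |p.wOne₂ lam K Xa Xb t| ≤ 700 * b / a := by
  have hpre := abs_prefactor_le hp ha hl hlb hK hK2
  have hh := abs_ht2_le hp ha
  obtain ⟨hσ, hσ2, -⟩ := σ_mem hp ha hl hlb
  obtain ⟨-, hA, hd, -, -⟩ := hp
  have hb : 0 < b := by linarith [hd.1, hd.2]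
  have hd' : |p.Dt21| ≤ b := by rw [abs_of_nonneg (by linarith [hd.1])]; exact hd.2
  have hσ' : |p.σ lam| ≤ 1 := by rw [abs_of_nonneg (by linarith [hσ.1])]; exact hσ.2
  have hσs : |p.σ lam ^ 2| ≤ 1 := by rw [abs_of_nonneg (sq_nonneg _)]; nlinarith [hσ.1, hσ.2]
  have hσi : |(p.σ lam)⁻¹| ≤ 2 := by
    rw [abs_of_nonneg (inv_nonneg.2 (by linarith [hσ.1]))]
    calc _ ≤ (1 / 2 : ℝ)⁻¹ := inv_anti₀ (by norm_num) hσ.1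
      _ = 2 := by norm_num
  have ha2 : Xa ^ 2 ≤ 4 := by nlinarith [sq_abs Xa, abs_nonneg Xa]
  have hb2 : Xb ^ 2 ≤ 4 := by nlinarith [sq_abs Xb, abs_nonneg Xb]
  have ha0 := sq_nonneg Xa
  have hb0 := sq_nonneg Xb
  have q1 : |Xa ^ 2 + Xb ^ 2| ≤ 8 := abs_le.2 ⟨by linarith, by linarith⟩
  have q2 : |2 * Xa * Xb| ≤ 8 := by
    have := abs_mul_le_of_le (abs_mul_le_of_le (abs_two (α := ℝ)).le hXa) hXb
    linarith
  have q3 : |Xb ^ 2 - Xa ^ 2| ≤ 4 := abs_le.2 ⟨by linarith, by linarith⟩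
  have q4 : |3 * Xb ^ 2 - Xa ^ 2| ≤ 16 := abs_le.2 ⟨by linarith, by linarith⟩
  have q5 : |Xb ^ 2 - 3 * Xa ^ 2| ≤ 16 := abs_le.2 ⟨by linarith, by linarith⟩
  have q6 : |p.σ lam ^ 2 + 2| ≤ 3 := abs_le.2 ⟨by nlinarith, by linarith [(abs_le.1 hσs).2]⟩
  have q7 : |2 * p.σ lam ^ 2 + 1| ≤ 3 := abs_le.2 ⟨by nlinarith, by linarith [(abs_le.1 hσs).2]⟩
  have q8 : |(2 / 3 : ℝ)| ≤ 1 := by norm_num [abs_of_pos]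
  have q9 : |(2 : ℝ)| ≤ 2 := by norm_num [abs_of_pos]
  have hc := fun s => Real.abs_cos_le_one s
  have hs := fun s => Real.abs_sin_le_one s
  constructor
  · rw [wOne₁]
    refine (abs_mul_le_of_le hpre (abs_sub_le_of_le (abs_add_le_of_le
      (abs_mul_le_of_le (abs_mul_le_of_le (abs_mul_le_of_le hd' hσs) q1)
        (abs_sub_le_of_le (abs_mul_le_of_le hXa (hc _)) (abs_mul_le_of_le hXb (hs _))))
      (abs_mul_le_of_le (abs_mul_le_of_le (abs_mul_le_of_le q8 hh) q6)
        (abs_sub_le_of_le (abs_mul_le_of_le q2 (hc _)) (abs_mul_le_of_le q3 (hs _)))))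
      (abs_mul_le_of_le (abs_mul_le_of_le hd' hσs)
        (abs_sub_le_of_le (abs_mul_le_of_le (abs_mul_le_of_le hXa q4) (hc _))
          (abs_mul_le_of_le (abs_mul_le_of_le hXb q5) (hs _)))))).trans ?_
    rw [div_mul_eq_mul_div]
    exact div_le_div_of_nonneg_right (by linarith) ha.le
  · rw [wOne₂]
    rw [div_eq_mul_inv _ (p.σ lam)]
    refine (abs_mul_le_of_le hpre (abs_sub_le_of_le (abs_sub_le_of_le (abs_add_le_of_le
      ((abs_neg _).trans_le (abs_mul_le_of_le (abs_mul_le_of_le (abs_mul_le_of_le hd' hσ') q1)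
        (abs_add_le_of_le (abs_mul_le_of_le hXb (hc _)) (abs_mul_le_of_le hXa (hs _)))))
      (abs_mul_le_of_le (abs_mul_le_of_le (abs_mul_le_of_le q8 hh) q7)
        (abs_add_le_of_le (abs_mul_le_of_le q3 (hc _)) (abs_mul_le_of_le q2 (hs _)))))
      (abs_mul_le_of_le (abs_mul_le_of_le hd' hσ')
        (abs_add_le_of_le (abs_mul_le_of_le (abs_mul_le_of_le hXb q5) (hc _))
          (abs_mul_le_of_le (abs_mul_le_of_le hXa q4) (hs _)))))
      (abs_mul_le_of_le (abs_mul_le_of_le (abs_mul_le_of_le q9 hh) q1) hσi))).trans ?_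
    rw [div_mul_eq_mul_div]
    exact div_le_div_of_nonneg_right (by linarith) ha.le

variable (p lam K w₁ w₂) in
/-- First component of the unperturbed elliptic motion at height `-K` started at `(w₁, w₂)`. -/
def ellipse₁ (t : ℝ) : ℝ := p.wZero₁ lam K (w₁ / (2 * p.σ lam)) (w₂ / 2) t

variable (p lam K w₁ w₂) in
/-- Second component of the unperturbed elliptic motion at height `-K` started at `(w₁, w₂)`. -/
def ellipse₂ (t : ℝ) : ℝ := p.wZero₂ lam K (w₁ / (2 * p.σ lam)) (w₂ / 2) t

/-- The corrections of first order, in the amplitudes and in the solution formula, keep the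
approximate motion within `O(lam)` of the ellipse, so only the ellipse matters below. -/
theorem abs_wApprox_sub_ellipse_le (hp : p ∈ paramSet a b) (ha : 0 < a) (hl : 0 < lam)
    (hlb : lam * b ≤ a / 2) (hK : 0 < K) (hK2 : 2 * K ^ 2 ≤ 1) (hw : w₁ ^ 2 + w₂ ^ 2 ≤ 1)
    (hlW : lam * (700 * b / a) ≤ 1) (t : ℝ) :
    |p.wApprox₁ lam K w₁ w₂ t - p.ellipse₁ lam K w₁ w₂ t| ≤ 5 * (lam * (700 * b / a)) ∧
      |p.wApprox₂ lam K w₁ w₂ t - p.ellipse₂ lam K w₁ w₂ t| ≤ 5 * (lam * (700 * b / a)) := by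
  obtain ⟨hσ, hσ2, -⟩ := σ_mem hp ha hl hlb
  have hσ0 : 0 < p.σ lam := by linarith [hσ.1]
  have hσ2i : |(2 * p.σ lam)⁻¹| ≤ 1 := by
    rw [abs_of_pos (by positivity)]
    exact inv_le_one_of_one_le₀ (by linarith [hσ.1])
  have hw1 : |w₁| ≤ 1 := abs_le_one_iff_mul_self_le_one.2 (by nlinarith)
  have hw2 : |w₂| ≤ 1 := abs_le_one_iff_mul_self_le_one.2 (by nlinarith)
  have hl' : |lam| ≤ lam := (abs_of_pos hl).le
  set W := 700 * b / a
  set xa := w₁ / (2 * p.σ lam) with hxa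
  set xb := w₂ / 2 with hxb
  have hxa1 : |xa| ≤ 1 := by
    have := abs_mul_le_of_le hw1 hσ2i
    rwa [← div_eq_mul_inv, one_mul] at this
  have hxb1 : |xb| ≤ 1 := by
    rw [hxb, abs_div, abs_two]
    linarith
  have hbd := fun {Xa Xb : ℝ} (hXa : |Xa| ≤ 2) (hXb : |Xb| ≤ 2) (t : ℝ) =>
    abs_wOne_le hp ha hl hlb hK hK2 hXa hXb t
  obtain ⟨h1, h2⟩ := hbd (Xa := xa) (Xb := xb) (by linarith) (by linarith) 0
  have hA : |p.ampA lam K w₁ w₂ - xa| ≤ lam * W := by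
    have e : p.ampA lam K w₁ w₂ - xa = -(lam * p.wOne₁ lam K xa xb 0 * (2 * p.σ lam)⁻¹) := by
      rw [ampA, ← hxa, ← hxb, div_eq_mul_inv _ (2 * p.σ lam)]
      ring
    rw [e, abs_neg]
    have := abs_mul_le_of_le (abs_mul_le_of_le hl' h1) hσ2i
    linarith
  have hB : |p.ampB lam K w₁ w₂ - xb| ≤ lam * W := by
    have e : p.ampB lam K w₁ w₂ - xb = -(lam * p.wOne₂ lam K xa xb 0) / 2 := by
      rw [ampB, ← hxa, ← hxb]
      ring
    rw [e, abs_div, abs_neg, abs_two]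
    have := abs_mul_le_of_le hl' h2
    linarith [abs_nonneg (lam * p.wOne₂ lam K xa xb 0)]
  set XA := p.ampA lam K w₁ w₂
  set XB := p.ampB lam K w₁ w₂
  have hXA : |XA| ≤ 2 := by linarith [abs_sub_abs_le_abs_sub XA xa]
  have hXB : |XB| ≤ 2 := by linarith [abs_sub_abs_le_abs_sub XB xb]
  obtain ⟨h3, h4⟩ := hbd hXA hXB t
  have h2σ : |2 * p.σ lam| ≤ 2 := by rw [abs_of_pos (by positivity)]; linarith [hσ.2]
  have hc := Real.abs_cos_le_one (t * p.freq lam K)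
  have hs := Real.abs_sin_le_one (t * p.freq lam K)
  constructor
  · have e : p.wApprox₁ lam K w₁ w₂ t - p.ellipse₁ lam K w₁ w₂ t =
        2 * p.σ lam * ((XA - xa) * Real.cos (t * p.freq lam K)
          - (XB - xb) * Real.sin (t * p.freq lam K)) + lam * p.wOne₁ lam K XA XB t := by
      simp only [wApprox₁, ellipse₁, wZero₁, XA, XB, xa, xb]
      ring
    rw [e]
    have := abs_add_le_of_le (abs_mul_le_of_le h2σ (abs_sub_le_of_le (abs_mul_le_of_le hA hc)
      (abs_mul_le_of_le hB hs))) (abs_mul_le_of_le hl' h3)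
    linarith
  · have e : p.wApprox₂ lam K w₁ w₂ t - p.ellipse₂ lam K w₁ w₂ t =
        2 * ((XB - xb) * Real.cos (t * p.freq lam K)
          + (XA - xa) * Real.sin (t * p.freq lam K)) + lam * p.wOne₂ lam K XA XB t := by
      simp only [wApprox₂, ellipse₂, wZero₂, XA, XB, xa, xb]
      ring
    rw [e]
    have := abs_add_le_of_le (abs_mul_le_of_le (abs_two (α := ℝ)).le (abs_add_le_of_le
      (abs_mul_le_of_le hB hc) (abs_mul_le_of_le hA hs))) (abs_mul_le_of_le hl' h4)
    linarith

theorem ellipse₁_eq (hσ : 0 < p.σ lam) (t : ℝ) : p.ellipse₁ lam K w₁ w₂ t =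
    w₁ * Real.cos (t * p.freq lam K) - p.σ lam * w₂ * Real.sin (t * p.freq lam K) := by
  rw [ellipse₁, wZero₁]
  field_simp

theorem ellipse₂_eq (hσ : 0 < p.σ lam) (t : ℝ) : p.ellipse₂ lam K w₁ w₂ t =
    w₂ * Real.cos (t * p.freq lam K) + w₁ / p.σ lam * Real.sin (t * p.freq lam K) := by
  rw [ellipse₂, wZero₂]
  field_simp

theorem hasDerivAt_ellipse (hp : p ∈ paramSet a b) (ha : 0 < a) (hl : 0 < lam)
    (hlb : lam * b ≤ a / 2) (t : ℝ) :
    HasDerivAt (p.ellipse₁ lam K w₁ w₂) (-(K * p.D32 lam * p.ellipse₂ lam K w₁ w₂ t)) t ∧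
      HasDerivAt (p.ellipse₂ lam K w₁ w₂) (K * p.D31 * p.ellipse₁ lam K w₁ w₂ t) t := by
  have hσ0 : 0 < p.σ lam := by linarith [(σ_mem hp ha hl hlb).1.1]
  have hω := freq_eq hp ha hl hlb K
  have hlin : HasDerivAt (fun t => t * p.freq lam K) (p.freq lam K) t := by
    simpa using (hasDerivAt_id' t).mul_const (p.freq lam K)
  have hc := hlin.cos
  have hs := hlin.sin
  rw [funext (ellipse₁_eq (K := K) (w₁ := w₁) (w₂ := w₂) hσ0),
    funext (ellipse₂_eq (K := K) (w₁ := w₁) (w₂ := w₂) hσ0), ← σ_sq hp ha hl hlb]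
  constructor
  · refine ((hc.const_mul w₁).sub (hs.const_mul (p.σ lam * w₂))).congr_deriv ?_
    rw [show ∀ x : ℝ, x * p.freq lam K = x * (K * (p.D31 * p.σ lam)) from fun x => by rw [hω]]
    rw [hω]
    field_simp
    ring
  · refine ((hc.const_mul w₂).add (hs.const_mul (w₁ / p.σ lam))).congr_deriv ?_
    rw [hω]
    field_simp
    ring

theorem ellipse_bounds (hp : p ∈ paramSet a b) (ha : 0 < a) (hl : 0 < lam)
    (hlb : lam * b ≤ a / 2) (hK2 : 2 * K ^ 2 ≤ 1) (hw : w₁ ^ 2 + w₂ ^ 2 = 1 - K ^ 2) (t : ℝ) :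
    1 / 4 ≤ p.ellipse₁ lam K w₁ w₂ t ^ 2 + p.ellipse₂ lam K w₁ w₂ t ^ 2 ∧
      |p.ellipse₁ lam K w₁ w₂ t| ≤ 3 / 2 ∧ |p.ellipse₂ lam K w₁ w₂ t| ≤ 3 / 2 := by
  obtain ⟨hσ, hσ2, -⟩ := σ_mem hp ha hl hlb
  have hσ0 : 0 < p.σ lam := by linarith [hσ.1]
  have hσ1 : p.σ lam ^ 2 ≤ 1 := by nlinarith [hσ.2]
  have hinv : p.ellipse₁ lam K w₁ w₂ t ^ 2 + p.σ lam ^ 2 * p.ellipse₂ lam K w₁ w₂ t ^ 2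
      = w₁ ^ 2 + p.σ lam ^ 2 * w₂ ^ 2 := by
    rw [ellipse₁_eq hσ0, ellipse₂_eq hσ0]
    have e : p.σ lam ^ 2 * (w₂ * Real.cos (t * p.freq lam K)
        + w₁ / p.σ lam * Real.sin (t * p.freq lam K)) ^ 2
        = (p.σ lam * w₂ * Real.cos (t * p.freq lam K) + w₁ * Real.sin (t * p.freq lam K)) ^ 2 := by
      field_simp
    rw [e]
    linear_combination (w₁ ^ 2 + p.σ lam ^ 2 * w₂ ^ 2) *
      Real.sin_sq_add_cos_sq (t * p.freq lam K)
  set e₁ := p.ellipse₁ lam K w₁ w₂ t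
  set e₂ := p.ellipse₂ lam K w₁ w₂ t
  have h1 := mul_le_mul_of_nonneg_right hσ1 (sq_nonneg e₂)
  have h2 := mul_le_mul_of_nonneg_right hσ2 (sq_nonneg e₂)
  have h3 := mul_le_mul_of_nonneg_right hσ1 (sq_nonneg w₂)
  have h4 := mul_le_mul_of_nonneg_right hσ2 (sq_nonneg w₂)
  have hK0 := sq_nonneg K
  have := sq_nonneg w₁
  refine ⟨by linarith, abs_le_of_sq_le_sq (by nlinarith [sq_nonneg e₂]) (by norm_num),
    abs_le_of_sq_le_sq (by nlinarith [sq_nonneg e₁]) (by norm_num)⟩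

theorem wApprox_bounds (hp : p ∈ paramSet a b) (ha : 0 < a) (hl : 0 < lam)
    (hlb : lam * b ≤ a / 2) (hK : 0 < K) (hK2 : 2 * K ^ 2 ≤ 1)
    (hw : w₁ ^ 2 + w₂ ^ 2 = 1 - K ^ 2) (hlW : lam * (700 * b / a) ≤ 1 / 320) (t : ℝ) :
    1 / 8 ≤ p.wApprox₁ lam K w₁ w₂ t ^ 2 + p.wApprox₂ lam K w₁ w₂ t ^ 2 ∧
      |p.wApprox₁ lam K w₁ w₂ t| ≤ 2 ∧ |p.wApprox₂ lam K w₁ w₂ t| ≤ 2 := by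
  obtain ⟨h1, h2, h3⟩ := ellipse_bounds hp ha hl hlb hK2 hw t
  obtain ⟨h4, h5⟩ := abs_wApprox_sub_ellipse_le (w₁ := w₁) (w₂ := w₂) hp ha hl hlb hK hK2
    (by linarith [sq_nonneg K]) (hlW.trans (by norm_num)) t
  set e₁ := p.ellipse₁ lam K w₁ w₂ t
  set e₂ := p.ellipse₂ lam K w₁ w₂ t
  set v₁ := p.wApprox₁ lam K w₁ w₂ t
  set v₂ := p.wApprox₂ lam K w₁ w₂ t
  have h6 : |v₁ - e₁| ≤ 1 / 64 := by linarith
  have h7 : |v₂ - e₂| ≤ 1 / 64 := by linarith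
  have h8 := abs_le.1 (abs_mul_le_of_le h6 h2)
  have h9 := abs_le.1 (abs_mul_le_of_le h7 h3)
  refine ⟨?_, by linarith [abs_sub_abs_le_abs_sub v₁ e₁],
    by linarith [abs_sub_abs_le_abs_sub v₂ e₂]⟩
  nlinarith [sq_nonneg (v₁ - e₁), sq_nonneg (v₂ - e₂), h8.1, h9.1]

/-! ### The transfer current -/

/-- A bound for the transfer current. -/
def currentBound (b : ℝ) : ℝ := 48 * b + 80 * b ^ 2

theorem abs_betaTr_le (hp : p ∈ paramSet a b) (ha : 0 < a) (hl : 0 < lam) (hl1 : lam ≤ 1)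
    (hlb : lam * b ≤ a / 2) (hK : 0 < K) (hK2 : 2 * K ^ 2 ≤ 1)
    (hw : w₁ ^ 2 + w₂ ^ 2 = 1 - K ^ 2) (hlW : lam * (700 * b / a) ≤ 1 / 320) (t : ℝ) :
    |p.betaTr lam K w₁ w₂ t| ≤ currentBound b := by
  obtain ⟨h1, h2, h3⟩ := wApprox_bounds hp ha hl hlb hK hK2 hw hlW t
  have hh := abs_ht2_le hp ha
  have hB := D32_mem hp ha hl hlb
  obtain ⟨-, hA, hd, hα, -⟩ := hp
  rw [betaTr, betaLat]
  set v₁ := p.wApprox₁ lam K w₁ w₂ t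
  set v₂ := p.wApprox₂ lam K w₁ w₂ t
  have hd' : |p.Dt21| ≤ b := by rw [abs_of_nonneg (by linarith [hd.1])]; exact hd.2
  have hα' : |p.αt| ≤ b := by rw [abs_of_nonneg hα.1.le]; exact hα.2
  have hA' : |p.D31| ≤ b := by rw [abs_of_nonneg (by linarith [hA.1])]; exact hA.2
  have hB' : |p.D32 lam| ≤ b := by rw [abs_of_nonneg (by linarith [hB.1])]; exact hB.2
  have hl' : |lam| ≤ 1 := by rw [abs_of_pos hl]; exact hl1
  have hK1 : |K| ≤ 1 := abs_le_one_iff_mul_self_le_one.2 (by nlinarith)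
  have hv1 : |v₁ ^ 2| ≤ 4 := by
    rw [abs_of_nonneg (sq_nonneg _)]
    nlinarith [sq_abs v₁, abs_nonneg v₁]
  have hv2 : |v₂ ^ 2| ≤ 4 := by
    rw [abs_of_nonneg (sq_nonneg _)]
    nlinarith [sq_abs v₂, abs_nonneg v₂]
  have hi : |(v₁ ^ 2 + v₂ ^ 2)⁻¹| ≤ 8 := by
    rw [abs_of_nonneg (inv_nonneg.2 (by positivity))]
    calc _ ≤ (1 / 8 : ℝ)⁻¹ := inv_anti₀ (by norm_num) h1
      _ = 8 := by norm_num
  refine (abs_mul_le_of_le hi (abs_sub_le_of_le (abs_add_le_of_le (abs_add_le_of_le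
    (abs_mul_le_of_le (abs_mul_le_of_le h2 h3) hd')
    (abs_mul_le_of_le (abs_mul_le_of_le hα' hK1) (abs_add_le_of_le (abs_mul_le_of_le hB' hv2)
      (abs_mul_le_of_le hA' hv1))))
    (abs_mul_le_of_le (abs_mul_le_of_le (abs_mul_le_of_le (abs_mul_le_of_le hα' hh) hl') h3) hK1))
    (abs_mul_le_of_le hh h2))).trans (le_of_eq ?_)
  rw [currentBound]
  ring

theorem continuous_betaTr (hp : p ∈ paramSet a b) (ha : 0 < a) (hl : 0 < lam)
    (hlb : lam * b ≤ a / 2) (hK : 0 < K) (hK2 : 2 * K ^ 2 ≤ 1)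
    (hw : w₁ ^ 2 + w₂ ^ 2 = 1 - K ^ 2) (hlW : lam * (700 * b / a) ≤ 1 / 320) :
    Continuous (p.betaTr lam K w₁ w₂) := by
  have h1 : Continuous (p.wApprox₁ lam K w₁ w₂) := by
    unfold wApprox₁ wZero₁ wOne₁
    fun_prop
  have h2 : Continuous (p.wApprox₂ lam K w₁ w₂) := by
    unfold wApprox₂ wZero₂ wOne₂
    fun_prop
  have h3 : Continuous (fun t => (p.wApprox₁ lam K w₁ w₂ t ^ 2 + p.wApprox₂ lam K w₁ w₂ t ^ 2)⁻¹) :=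
    ((h1.pow 2).add (h2.pow 2)).inv₀ fun t =>
      (lt_of_lt_of_le (by norm_num) (wApprox_bounds hp ha hl hlb hK hK2 hw hlW t).1).ne'
  unfold betaTr betaLat
  fun_prop

/-! ### The quasi-latitudinal transfer -/

/-- The height changes slowly as long as the state is close to the point at which the feedback is
evaluated, because there the current makes the height stationary. -/
theorem abs_field_two_le (hp : p ∈ paramSet a b) (ha : 0 < a) (hl : 0 < lam) (hl1 : lam ≤ 1)
    (hlb : lam * b ≤ a / 2) (hK2 : 2 * K ^ 2 ≤ 1) {v₁ v₂ β D : ℝ} (hv₁ : |v₁| ≤ 2) (hv₂ : |v₂| ≤ 2)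
    (hv : 0 < v₁ ^ 2 + v₂ ^ 2) (hβ : β = p.betaLat lam K v₁ v₂) (hβM : |β| ≤ currentBound b)
    {u : E3} (hu : ‖u‖ = 1) (h0 : |u 0 - v₁| ≤ D) (h1 : |u 1 - v₂| ≤ D) (h2 : |u 2 + K| ≤ D) :
    |p.field lam β u 2| ≤ lam * ((4 * b + 10 * b ^ 2 + 6 * currentBound b) * D) := by
  have hh := abs_ht2_le hp ha
  have hB := D32_mem hp ha hl hlb
  obtain ⟨-, hA, hd, hα, -⟩ := hp
  have hd' : |p.Dt21| ≤ b := by rw [abs_of_nonneg (by linarith [hd.1])]; exact hd.2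
  have hα' : |p.αt| ≤ b := by rw [abs_of_nonneg hα.1.le]; exact hα.2
  have hA' : |p.D31| ≤ b := by rw [abs_of_nonneg (by linarith [hA.1])]; exact hA.2
  have hB' : |p.D32 lam| ≤ b := by rw [abs_of_nonneg (by linarith [hB.1])]; exact hB.2
  have hl' : |lam| ≤ 1 := by rw [abs_of_pos hl]; exact hl1
  have hK1 : |K| ≤ 1 := abs_le_one_iff_mul_self_le_one.2 (by nlinarith)
  have hx := (E3_abs_le_norm u 0).trans_eq hu
  have hy := (E3_abs_le_norm u 1).trans_eq hu
  have hx2 : |u 0 ^ 2| ≤ 1 := by rw [sq]; simpa using abs_mul_le_of_le hx hx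
  have hy2 : |u 1 ^ 2| ≤ 1 := by rw [sq]; simpa using abs_mul_le_of_le hy hy
  have hsum : β * (v₁ ^ 2 + v₂ ^ 2) = v₁ * v₂ * p.Dt21
      + p.αt * K * (p.D32 lam * v₂ ^ 2 + p.D31 * v₁ ^ 2)
      + p.αt * p.ht2 * lam * v₂ * K - p.ht2 * v₁ := by
    rw [hβ, betaLat]
    field_simp
  have s0 : |(u 0 - v₁) * (u 0 + v₁)| ≤ D * (1 + 2) :=
    abs_mul_le_of_le h0 (abs_add_le_of_le hx hv₁)
  have s1 : |(u 1 - v₂) * (u 1 + v₂)| ≤ D * (1 + 2) :=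
    abs_mul_le_of_le h1 (abs_add_le_of_le hy hv₂)
  have e : p.field lam β u 2 = lam * (
      (-(p.ht2 * (u 0 - v₁)) + (u 0 * (u 1 - v₂) + (u 0 - v₁) * v₂) * p.Dt21)
      - p.αt * (p.D32 lam * ((u 2 + K) * u 1 ^ 2 - K * ((u 1 - v₂) * (u 1 + v₂)))
          + p.D31 * ((u 2 + K) * u 0 ^ 2 - K * ((u 0 - v₁) * (u 0 + v₁))))
      - p.αt * p.ht2 * lam * (u 1 * (u 2 + K) - K * (u 1 - v₂))
      - ((u 0 - v₁) * (u 0 + v₁) + (u 1 - v₂) * (u 1 + v₂)) * β) := by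
    simp only [field, PiLp.toLp_apply, Matrix.cons_val]
    linear_combination (-lam) * hsum
  rw [e]
  refine (abs_mul_le_of_le (abs_of_pos hl).le (abs_sub_le_of_le (abs_sub_le_of_le (abs_sub_le_of_le
    (abs_add_le_of_le ((abs_neg _).trans_le (abs_mul_le_of_le hh h0))
      (abs_mul_le_of_le (abs_add_le_of_le (abs_mul_le_of_le hx h1) (abs_mul_le_of_le h0 hv₂)) hd'))
    (abs_mul_le_of_le hα' (abs_add_le_of_le
      (abs_mul_le_of_le hB' (abs_sub_le_of_le (abs_mul_le_of_le h2 hy2) (abs_mul_le_of_le hK1 s1)))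
      (abs_mul_le_of_le hA'
        (abs_sub_le_of_le (abs_mul_le_of_le h2 hx2) (abs_mul_le_of_le hK1 s0))))))
    (abs_mul_le_of_le (abs_mul_le_of_le (abs_mul_le_of_le hα' hh) hl')
      (abs_sub_le_of_le (abs_mul_le_of_le hy h2) (abs_mul_le_of_le hK1 h1))))
    (abs_mul_le_of_le (abs_add_le_of_le s0 s1) hβM))).trans (le_of_eq ?_)
  ring

/-- A bound for the parts of the horizontal components of the field which are of first order in
`lam`. -/
def driftBound (b : ℝ) : ℝ := b + currentBound b + 4 * b ^ 2

theorem abs_field_horizontal_le (hp : p ∈ paramSet a b) (ha : 0 < a) (hl : 0 < lam)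
    (hl1 : lam ≤ 1) (hlb : lam * b ≤ a / 2) {β : ℝ} (hβM : |β| ≤ currentBound b) {u : E3}
    (hu : ‖u‖ = 1) :
    |p.field lam β u 0 - p.D32 lam * u 1 * u 2| ≤ lam * driftBound b ∧
      |p.field lam β u 1 + p.D31 * u 0 * u 2| ≤ lam * driftBound b := by
  have hh := abs_ht2_le hp ha
  have hB := D32_mem hp ha hl hlb
  obtain ⟨-, hA, hd, hα, -⟩ := hp
  have hb : 0 ≤ b := by linarith [hd.1, hd.2]
  have hd' : |p.Dt21| ≤ b := by rw [abs_of_nonneg (by linarith [hd.1])]; exact hd.2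
  have hα' : |p.αt| ≤ b := by rw [abs_of_nonneg hα.1.le]; exact hα.2
  have hA' : |p.D31| ≤ b := by rw [abs_of_nonneg (by linarith [hA.1])]; exact hA.2
  have hB' : |p.D32 lam| ≤ b := by rw [abs_of_nonneg (by linarith [hB.1])]; exact hB.2
  have hl' : |lam| ≤ 1 := by rw [abs_of_pos hl]; exact hl1
  have hx := (E3_abs_le_norm u 0).trans_eq hu
  have hy := (E3_abs_le_norm u 1).trans_eq hu
  have hz := (E3_abs_le_norm u 2).trans_eq hu
  have hx2 : |u 0 ^ 2| ≤ 1 := by rw [sq]; simpa using abs_mul_le_of_le hx hx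
  have hz2 : |u 2 ^ 2| ≤ 1 := by rw [sq]; simpa using abs_mul_le_of_le hz hz
  have hM : 0 ≤ currentBound b := by unfold currentBound; positivity
  constructor
  · have e : p.field lam β u 0 - p.D32 lam * u 1 * u 2 = lam * (p.ht2 * u 2 + u 0 * u 2 * β
        + p.αt * u 0 * p.D31 * u 2 ^ 2 + p.αt * lam * u 0 * u 1 * (p.Dt21 * u 1 - p.ht2)) := by
      simp only [field, PiLp.toLp_apply, Matrix.cons_val]
      ring
    rw [e]
    refine (abs_mul_le_of_le (abs_of_pos hl).le (abs_add_le_of_le (abs_add_le_of_le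
      (abs_add_le_of_le (abs_mul_le_of_le hh hz) (abs_mul_le_of_le (abs_mul_le_of_le hx hz) hβM))
      (abs_mul_le_of_le (abs_mul_le_of_le (abs_mul_le_of_le hα' hx) hA') hz2))
      (abs_mul_le_of_le (abs_mul_le_of_le (abs_mul_le_of_le (abs_mul_le_of_le hα' hl') hx) hy)
        (abs_sub_le_of_le (abs_mul_le_of_le hd' hy) hh)))).trans ?_
    refine mul_le_mul_of_nonneg_left ?_ hl.le
    rw [driftBound]
    nlinarith
  · have e : p.field lam β u 1 + p.D31 * u 0 * u 2 = lam * (u 1 * u 2 * (β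
        + p.αt * p.D32 lam * u 2)
        + p.αt * lam * (p.ht2 * (u 0 ^ 2 + u 2 ^ 2) - p.Dt21 * u 0 ^ 2 * u 1)) := by
      simp only [field, PiLp.toLp_apply, Matrix.cons_val]
      ring
    rw [e]
    refine (abs_mul_le_of_le (abs_of_pos hl).le (abs_add_le_of_le
      (abs_mul_le_of_le (abs_mul_le_of_le hy hz)
        (abs_add_le_of_le hβM (abs_mul_le_of_le (abs_mul_le_of_le hα' hB') hz)))
      (abs_mul_le_of_le (abs_mul_le_of_le hα' hl') (abs_sub_le_of_le
        (abs_mul_le_of_le hh (abs_add_le_of_le hx2 hz2))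
        (abs_mul_le_of_le (abs_mul_le_of_le hd' hx2) hy))))).trans ?_
    refine mul_le_mul_of_nonneg_left ?_ hl.le
    rw [driftBound]
    nlinarith

end Params

namespace Params

variable {p : Params} {lam a b K κ w₁ w₂ T : ℝ} {u : ℝ → E3}

/-- The Lipschitz constant in `abs_field_two_le`. -/
def heightRate (b : ℝ) : ℝ := 4 * b + 10 * b ^ 2 + 6 * currentBound b

/-- The growth rate, in the slow time `√lam t`, of the squared distance between the controlled
motion and the ellipse. -/
def growthRate (a b : ℝ) : ℝ :=
  driftBound b + 2 * b + heightRate b * (2 + 5 * (700 * b / a))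

theorem quadratic_form_le {q₁ q₂ r s R b L W : ℝ} (hr : 0 ≤ r)
    (hs : 0 ≤ s) (hs1 : s ≤ 1) (hR : 0 ≤ R) (hb : 0 ≤ b) (hL : 0 ≤ L) (hW : 0 ≤ W) :
    s * q₁ * R + s * q₂ * R + b * (q₁ * r) + b * (q₂ * r) + b * (q₁ * q₂)
      + L * (r * (q₁ + q₂ + 5 * (s ^ 2 * W) + s * r))
      ≤ (R + 2 * b + L * (2 + 5 * W)) * (q₁ ^ 2 + q₂ ^ 2 + r ^ 2 + s ^ 2) := by
  set f := q₁ ^ 2 + q₂ ^ 2 + r ^ 2 + s ^ 2 with hf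
  have a1 : s * q₁ + s * q₂ ≤ f := by
    nlinarith [sq_nonneg (s - q₁ - q₂), sq_nonneg (q₁ - q₂), sq_nonneg r]
  have a2 : q₁ * r + q₂ * r + q₁ * q₂ ≤ 2 * f := by
    nlinarith [sq_nonneg (q₁ - r), sq_nonneg (q₂ - r), sq_nonneg (q₁ - q₂), sq_nonneg s]
  have a3 : r * s ^ 2 ≤ f := by
    have : r * s ^ 2 ≤ r * s := mul_le_mul_of_nonneg_left (by nlinarith) hr
    nlinarith [sq_nonneg (r - s), sq_nonneg q₁, sq_nonneg q₂, mul_nonneg hr hs]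
  have a4 : r * q₁ + r * q₂ + s * r ^ 2 ≤ 2 * f := by
    have : s * r ^ 2 ≤ r ^ 2 := by nlinarith [sq_nonneg r]
    nlinarith [sq_nonneg (q₁ - r), sq_nonneg (q₂ - r), sq_nonneg s]
  have b1 := mul_le_mul_of_nonneg_left a1 hR
  have b2 := mul_le_mul_of_nonneg_left a2 hb
  have b3 := mul_le_mul_of_nonneg_left a3 (mul_nonneg hL hW)
  have b4 := mul_le_mul_of_nonneg_left a4 hL
  linarith

/-- The differential inequality behind `Solves.sq_dist_ellipse_le`, for the horizontal deviations
`δ₁`, `δ₂` from the ellipse and the scaled height deviation `ζ`. -/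
theorem deviation_le {A B lam s K b R L W δ₁ δ₂ ζ x y z e₁ e₂ F₀ F₁ F₂ : ℝ} (hs0 : 0 < s)
    (hs1 : s ≤ 1) (hs2 : s ^ 2 = lam) (hK : 0 ≤ K) (hK1 : K ≤ 1) (hb : 0 ≤ b) (hR : 0 ≤ R)
    (hL : 0 ≤ L) (hW : 0 ≤ W) (hB : |B| ≤ b) (hA : |A| ≤ b) (hAB : A - B ∈ Icc 0 (lam * b))
    (hx : |x| ≤ 1) (hy : |y| ≤ 1) (hδ₁ : δ₁ = x - e₁) (hδ₂ : δ₂ = y - e₂) (hz : z + K = s * ζ)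
    (hF₀ : |F₀ - B * y * z| ≤ lam * R) (hF₁ : |F₁ + A * x * z| ≤ lam * R)
    (hF₂ : |F₂| ≤ lam * (L * (|δ₁| + |δ₂| + 5 * (lam * W) + s * |ζ|))) :
    δ₁ * (F₀ + K * B * e₂) + δ₂ * (F₁ - K * A * e₁) + ζ * (F₂ / s)
      ≤ s * (R + 2 * b + L * (2 + 5 * W)) * (δ₁ ^ 2 + δ₂ ^ 2 + ζ ^ 2 + lam) := by
  subst hs2
  have t0 : δ₁ * (F₀ + K * B * e₂) ≤
      |δ₁| * (s ^ 2 * R) + s * (b * (|δ₁| * |ζ|)) - B * K * (δ₁ * δ₂) := by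
    have e : δ₁ * (F₀ + K * B * e₂) = δ₁ * (F₀ - B * y * z)
        + s * (B * y * (δ₁ * ζ)) - B * K * (δ₁ * δ₂) := by
      linear_combination δ₁ * B * y * hz + δ₁ * B * K * hδ₂
    have h1 := (abs_le.1 (abs_mul_le_of_le (le_refl |δ₁|) hF₀)).2
    have h2 := (abs_le.1 (abs_mul_le_of_le (abs_mul_le_of_le hB hy)
      (abs_mul_le_of_le (le_refl |δ₁|) (le_refl |ζ|)))).2
    have h3 := mul_le_mul_of_nonneg_left h2 hs0.le
    rw [e]
    linarith only [h1, h3]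
  have t1 : δ₂ * (F₁ - K * A * e₁) ≤
      |δ₂| * (s ^ 2 * R) + s * (b * (|δ₂| * |ζ|)) + A * K * (δ₁ * δ₂) := by
    have e : δ₂ * (F₁ - K * A * e₁) = δ₂ * (F₁ + A * x * z)
        - s * (A * x * (δ₂ * ζ)) + A * K * (δ₁ * δ₂) := by
      linear_combination (-δ₂) * A * x * hz - δ₂ * A * K * hδ₁
    have h1 := (abs_le.1 (abs_mul_le_of_le (le_refl |δ₂|) hF₁)).2
    have h2 := (abs_le.1 (abs_mul_le_of_le (abs_mul_le_of_le hA hx)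
      (abs_mul_le_of_le (le_refl |δ₂|) (le_refl |ζ|)))).1
    have h3 := mul_le_mul_of_nonneg_left h2 hs0.le
    rw [e]
    linarith only [h1, h3]
  have t01 : (A - B) * K * (δ₁ * δ₂) ≤ s * (b * (|δ₁| * |δ₂|)) := by
    have hAB' : |A - B| ≤ s * b := by
      rw [abs_of_nonneg hAB.1]
      nlinarith [hAB.2, mul_nonneg hs0.le hb]
    have h := (abs_le.1 (abs_mul_le_of_le (abs_mul_le_of_le hAB'
      ((abs_of_nonneg hK).trans_le hK1)) (abs_mul_le_of_le (le_refl |δ₁|) (le_refl |δ₂|)))).2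
    linarith only [h]
  have t2 : ζ * (F₂ / s) ≤ s * (L * (|ζ| * (|δ₁| + |δ₂| + 5 * (s ^ 2 * W) + s * |ζ|))) := by
    have h1 := (abs_le.1 (abs_mul_le_of_le (le_refl |ζ|) hF₂)).2
    rw [← mul_div_assoc, div_le_iff₀ hs0]
    exact h1.trans (le_of_eq (by ring))
  have hq := quadratic_form_le (q₁ := |δ₁|) (q₂ := |δ₂|) (abs_nonneg ζ) hs0.le hs1 hR hb hL hW
  rw [sq_abs, sq_abs, sq_abs] at hq
  have hq' := mul_le_mul_of_nonneg_left hq hs0.le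
  linarith only [t0, t1, t01, t2, hq']

/-- In the variables `u₁ - e₁`, `u₂ - e₂`, `(u₃ + K) / √lam`, where `e` is the ellipse, the
controlled motion is a rotation up to terms of relative size `√lam`; over times of order `1 / √lam`
it stays `O(√lam)`-close to the ellipse at `O(lam)`-constant height. -/
theorem Solves.sq_dist_ellipse_le (hp : p ∈ paramSet a b) (ha : 0 < a) (hl : 0 < lam)
    (hl1 : lam ≤ 1) (hlb : lam * b ≤ a / 2) (hK : 0 < K) (hK2 : 2 * K ^ 2 ≤ 1)
    (hw : w₁ ^ 2 + w₂ ^ 2 = 1 - K ^ 2) (hlW : lam * (700 * b / a) ≤ 1 / 320)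
    (hu : p.Solves lam (p.betaTr lam K w₁ w₂) 0 T u) (hu0 : u 0 = !₂[w₁, w₂, -K]) {t : ℝ}
    (ht : t ∈ Icc 0 T) :
    (u t 0 - p.ellipse₁ lam K w₁ w₂ t) ^ 2 + (u t 1 - p.ellipse₂ lam K w₁ w₂ t) ^ 2
      + ((u t 2 + K) / √lam) ^ 2 ≤ lam * Real.exp (2 * (√lam * growthRate a b) * t) := by
  have hσ0 : 0 < p.σ lam := by linarith [(σ_mem hp ha hl hlb).1.1]
  have hA := hp.2.1
  have hd := hp.2.2.1
  have hB := D32_mem hp ha hl hlb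
  have hb : 0 < b := by linarith [hA.1, hA.2]
  set s := √lam with hs
  have hs0 : 0 < s := Real.sqrt_pos.2 hl
  have hs2 : s ^ 2 = lam := Real.sq_sqrt hl.le
  have hs1 : s ≤ 1 := by nlinarith
  have hM : 0 ≤ currentBound b := by unfold currentBound; positivity
  have hR : 0 ≤ driftBound b := by unfold driftBound; positivity
  have hL : 0 ≤ heightRate b := by unfold heightRate; positivity
  have hW : 0 ≤ 700 * b / a := by positivity
  have hK1 : K ≤ 1 := by nlinarith
  let e₁ := p.ellipse₁ lam K w₁ w₂
  let e₂ := p.ellipse₂ lam K w₁ w₂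
  have he := fun t => hasDerivAt_ellipse (K := K) (w₁ := w₁) (w₂ := w₂) hp ha hl hlb t
  have he₁ : ∀ t, HasDerivAt e₁ (-(K * p.D32 lam * e₂ t)) t := fun t => (he t).1
  have he₂ : ∀ t, HasDerivAt e₂ (K * p.D31 * e₁ t) t := fun t => (he t).2
  let β := p.betaTr lam K w₁ w₂
  have hn0 : ‖u 0‖ = 1 := by
    have h := E3_norm_sq (u 0)
    rw [hu0] at h
    simp only [Matrix.cons_val] at h
    rw [hu0]
    exact (pow_left_inj₀ (norm_nonneg _) zero_le_one two_ne_zero).1 (by linarith)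
  have hd' : ∀ t ∈ Ioo 0 T, HasDerivAt
      (fun t => (u t 0 - e₁ t) ^ 2 + (u t 1 - e₂ t) ^ 2 + ((u t 2 + K) / s) ^ 2 + lam)
      (2 * ((u t 0 - e₁ t) * (p.field lam (β t) (u t) 0 + K * p.D32 lam * e₂ t)
        + (u t 1 - e₂ t) * (p.field lam (β t) (u t) 1 - K * p.D31 * e₁ t)
        + ((u t 2 + K) / s) * (p.field lam (β t) (u t) 2 / s))) t := by
    intro t ht
    have hd := Solves.hasDerivAt hu ht
    have h0 := ((E3_hasDerivAt_apply hd 0).sub (he₁ t)).pow 2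
    have h1 := ((E3_hasDerivAt_apply hd 1).sub (he₂ t)).pow 2
    have h2 := (((E3_hasDerivAt_apply hd 2).add_const K).div_const s).pow 2
    refine (((h0.add h1).add h2).add_const lam).congr_deriv ?_
    simp only [β, Pi.sub_apply]
    ring
  have hle : ∀ t ∈ Ioo 0 T,
      2 * ((u t 0 - e₁ t) * (p.field lam (β t) (u t) 0 + K * p.D32 lam * e₂ t)
        + (u t 1 - e₂ t) * (p.field lam (β t) (u t) 1 - K * p.D31 * e₁ t)
        + ((u t 2 + K) / s) * (p.field lam (β t) (u t) 2 / s))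
      ≤ 2 * (s * growthRate a b) *
        ((u t 0 - e₁ t) ^ 2 + (u t 1 - e₂ t) ^ 2 + ((u t 2 + K) / s) ^ 2 + lam) := by
    intro t ht
    have hn : ‖u t‖ = 1 := (Solves.norm_eq hu (Ioo_subset_Icc_self ht)).trans hn0
    have hβ := abs_betaTr_le hp ha hl hl1 hlb hK hK2 hw hlW t
    obtain ⟨hv, hv1, hv2⟩ := wApprox_bounds hp ha hl hlb hK hK2 hw hlW t
    obtain ⟨hve1, hve2⟩ := abs_wApprox_sub_ellipse_le (w₁ := w₁) (w₂ := w₂) hp ha hl hlb hK hK2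
      (by linarith [sq_nonneg K]) (hlW.trans (by norm_num)) t
    obtain ⟨hg0, hg1⟩ := abs_field_horizontal_le hp ha hl hl1 hlb hβ hn
    have hx := (E3_abs_le_norm (u t) 0).trans_eq hn
    have hy := (E3_abs_le_norm (u t) 1).trans_eq hn
    set δ₁ := u t 0 - e₁ t with hδ₁
    set δ₂ := u t 1 - e₂ t with hδ₂
    set ζ := (u t 2 + K) / s with hζ
    have hzK : u t 2 + K = s * ζ := by rw [hζ]; field_simp
    have hz' : |u t 2 + K| = s * |ζ| := by rw [hzK, abs_mul, abs_of_pos hs0]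
    have hsz : 0 ≤ s * |ζ| := by positivity
    have hlW0 : 0 ≤ 5 * (lam * (700 * b / a)) := by positivity
    have hf2 := abs_field_two_le (D := |δ₁| + |δ₂| + 5 * (lam * (700 * b / a)) + s * |ζ|)
      hp ha hl hl1 hlb hK2 hv1 hv2
      (lt_of_lt_of_le (by norm_num) hv) rfl hβ hn
      (by
        have := abs_sub_le (u t 0) (e₁ t) (p.wApprox₁ lam K w₁ w₂ t)
        rw [abs_sub_comm (e₁ t)] at this
        linarith [abs_nonneg δ₂])
      (by
        have := abs_sub_le (u t 1) (e₂ t) (p.wApprox₂ lam K w₁ w₂ t)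
        rw [abs_sub_comm (e₂ t)] at this
        linarith [abs_nonneg δ₁])
      (by rw [hz']; linarith [abs_nonneg δ₁, abs_nonneg δ₂])
    have hB' : |p.D32 lam| ≤ b := by rw [abs_of_nonneg (by linarith [hB.1])]; exact hB.2
    have hA' : |p.D31| ≤ b := by rw [abs_of_nonneg (by linarith [hA.1])]; exact hA.2
    set F := p.field lam (β t) (u t)
    replace hf2 : |F 2| ≤ lam * (heightRate b *
        (|δ₁| + |δ₂| + 5 * (lam * (700 * b / a)) + s * |ζ|)) := hf2
    have h := deviation_le hs0 hs1 hs2 hK.le hK1 hb.le hR hL hW hB' hA'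
      (by rw [D32_eq, sub_sub_cancel]; exact ⟨(mul_pos hl (ha.trans_le hd.1)).le,
        mul_le_mul_of_nonneg_left hd.2 hl.le⟩) hx hy hδ₁ hδ₂ hzK hg0 hg1 hf2
    rw [growthRate]
    linarith only [h]
  have hcont : ContinuousOn
      (fun t => (u t 0 - e₁ t) ^ 2 + (u t 1 - e₂ t) ^ 2 + ((u t 2 + K) / s) ^ 2 + lam)
      (Icc 0 T) := by
    have c0 := E3_continuousOn_apply hu.1 0
    have c1 := E3_continuousOn_apply hu.1 1
    have c2 := E3_continuousOn_apply hu.1 2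
    have c3 : ContinuousOn e₁ (Icc 0 T) := fun t _ => (he₁ t).continuousAt.continuousWithinAt
    have c4 : ContinuousOn e₂ (Icc 0 T) := fun t _ => (he₂ t).continuousAt.continuousWithinAt
    exact ((((c0.sub c3).pow 2).add ((c1.sub c4).pow 2)).add
      (((c2.add continuousOn_const).div_const s).pow 2)).add continuousOn_const
  have h := le_mul_exp_of_hasDerivAt_le hcont hd' hle ht
  have hi1 : e₁ 0 = w₁ := by simp [e₁, ellipse₁_eq hσ0]
  have hi2 : e₂ 0 = w₂ := by simp [e₂, ellipse₂_eq hσ0]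
  simp only [hu0, hi1, hi2, PiLp.toLp_apply, Matrix.cons_val, sub_self, neg_add_cancel, zero_div,
    ne_eq, OfNat.ofNat_ne_zero, not_false_eq_true, zero_pow, zero_add, sub_zero] at h
  linarith

theorem exists_angle {c d : ℝ} (h : c ^ 2 + d ^ 2 = 1) :
    ∃ θ, 0 < θ ∧ θ ≤ 8 ∧ Real.cos θ = c ∧ Real.sin θ = d := by
  have hn : ‖(⟨c, d⟩ : ℂ)‖ = 1 := by
    rw [Complex.norm_def, Complex.normSq_mk, ← sq, ← sq, h, Real.sqrt_one]
  have hne : (⟨c, d⟩ : ℂ) ≠ 0 := by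
    rw [← norm_ne_zero_iff, hn]
    exact one_ne_zero
  have hc := Complex.cos_arg hne
  have hs := Complex.sin_arg (⟨c, d⟩ : ℂ)
  rw [hn, div_one] at hc hs
  have hlo := Complex.neg_pi_lt_arg (⟨c, d⟩ : ℂ)
  have hhi := Complex.arg_le_pi (⟨c, d⟩ : ℂ)
  have hpi := Real.pi_le_four
  rcases lt_or_ge 0 (Complex.arg ⟨c, d⟩) with h0 | h0
  · exact ⟨_, h0, by linarith, hc, hs⟩
  · exact ⟨Complex.arg ⟨c, d⟩ + 2 * Real.pi, by linarith, by linarith,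
      by rw [Real.cos_add_two_pi, hc], by rw [Real.sin_add_two_pi, hs]⟩

theorem γ_sq (hp : p ∈ paramSet a b) (ha : 0 < a) : p.γ ^ 2 = 1 - p.Ω ^ 2 := by
  have hΩ := hp.2.2.2.2
  exact Real.sq_sqrt (by nlinarith [hΩ.1, hΩ.2])

/-- The rotation that carries the direction of `(w₁, w₂)` into the direction of `(γ, -Ω)`. -/
theorem exists_rotation {ρ g o : ℝ} (hρ : 0 < ρ) (hw : w₁ ^ 2 + w₂ ^ 2 = ρ ^ 2)
    (hg : g ^ 2 + o ^ 2 = 1) : ∃ θ, 0 < θ ∧ θ ≤ 8 ∧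
      w₁ * Real.cos θ - w₂ * Real.sin θ = ρ * g ∧
      w₂ * Real.cos θ + w₁ * Real.sin θ = -(ρ * o) := by
  obtain ⟨θ, hθ0, hθ8, hc, hs⟩ := exists_angle (c := (g * w₁ - o * w₂) / ρ)
    (d := (-(o * w₁) - g * w₂) / ρ) (by
      rw [div_pow, div_pow, ← add_div, div_eq_one_iff_eq (by positivity)]
      linear_combination (g ^ 2 + o ^ 2) * hw + ρ ^ 2 * hg)
  refine ⟨θ, hθ0, hθ8, ?_, ?_⟩
  · rw [hc, hs]
    field_simp
    linear_combination g * hw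
  · rw [hc, hs]
    field_simp
    linear_combination (-o) * hw

theorem abs_inv_sub_one_le {x m : ℝ} (hx : 1 / 2 ≤ x) (hm : |1 - x| ≤ m) :
    |x⁻¹ - 1| ≤ 2 * m := by
  have hx0 : 0 < x := by linarith
  have e : x⁻¹ - 1 = x⁻¹ * (1 - x) := by field_simp
  rw [e]
  refine abs_mul_le_of_le ?_ hm
  rw [abs_of_pos (by positivity)]
  calc _ ≤ (1 / 2 : ℝ)⁻¹ := inv_anti₀ (by norm_num) hx
    _ = 2 := by norm_num

/-- The ellipse through `(w₁, w₂)` is `O(lam)`-close to the unit circle, so that it passes near the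
target `s⁺` within about one turn. -/
theorem exists_ellipse_near_target (hp : p ∈ paramSet a b) (ha : 0 < a) (ha1 : a < 1)
    (hl : 0 < lam) (hlb : lam * b ≤ a / 2) (hκ : 0 < κ) (hκ1 : κ ≤ 1)
    (hK2 : 2 * (κ * √lam) ^ 2 ≤ 1) (hw : w₁ ^ 2 + w₂ ^ 2 = 1 - (κ * √lam) ^ 2) :
    ∃ T > 0, √lam * T ≤ 16 / (κ * a) ∧
      |p.ellipse₁ lam (κ * √lam) w₁ w₂ T - p.γ| ≤ lam * (2 * (b / a) + 1) ∧
      |p.ellipse₂ lam (κ * √lam) w₁ w₂ T - (-p.Ω)| ≤ lam * (2 * (b / a) + 1) := by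
  obtain ⟨hσ, hσ2, hσ3⟩ := σ_mem hp ha hl hlb
  have hσ0 : 0 < p.σ lam := by linarith [hσ.1]
  have hω := freq_eq hp ha hl hlb (κ * √lam)
  have hγ := γ_sq hp ha
  have hγ0 : 0 ≤ p.γ := Real.sqrt_nonneg _
  obtain ⟨-, hA, -, -, hΩ⟩ := hp
  have hb : 0 < b := by linarith [hA.1, hA.2]
  have hs0 : 0 < √lam := Real.sqrt_pos.2 hl
  have hs2 : √lam ^ 2 = lam := Real.sq_sqrt hl.le
  have hKl : (κ * √lam) ^ 2 ≤ lam := by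
    rw [mul_pow, hs2]
    exact mul_le_of_le_one_left hl.le (pow_le_one₀ hκ.le hκ1)
  set K := κ * √lam with hKdef
  have hK0 : 0 < K := mul_pos hκ hs0
  set ρ := √(1 - K ^ 2) with hρ
  have hρ2 : ρ ^ 2 = 1 - K ^ 2 := Real.sq_sqrt (by linarith)
  have hρ0 : 0 < ρ := Real.sqrt_pos.2 (by linarith)
  have hρ1 : ρ ≤ 1 := by nlinarith [sq_nonneg K]
  have hρ3 : 1 - ρ ≤ lam := by nlinarith
  obtain ⟨θ, hθ0, hθ8, r1, r2⟩ := exists_rotation (w₁ := w₁) (w₂ := w₂) (g := p.γ) (o := p.Ω) hρ0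
    (hw.trans hρ2.symm) (by rw [hγ]; ring)
  have hA0 : 0 < p.D31 := ha.trans_le hA.1
  have hω0 : 0 < p.freq lam K := by rw [hω]; positivity
  have hT : θ / p.freq lam K * p.freq lam K = θ := div_mul_cancel₀ _ hω0.ne'
  have hw1 : |w₁| ≤ 1 := abs_le_one_iff_mul_self_le_one.2 (by nlinarith [sq_nonneg K])
  have hw2 : |w₂| ≤ 1 := abs_le_one_iff_mul_self_le_one.2 (by nlinarith [sq_nonneg K])
  have hsθ := Real.abs_sin_le_one θ
  have hγ1 : |p.γ| ≤ 1 := abs_le_one_iff_mul_self_le_one.2 (by nlinarith [sq_nonneg p.Ω])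
  have hΩ1 : |p.Ω| ≤ 1 := by rw [abs_of_pos hΩ.1]; linarith [hΩ.2]
  have hba : 0 ≤ lam * (b / a) := by positivity
  have hσa : |1 - p.σ lam| ≤ lam * (b / a) := by
    rw [abs_of_nonneg (by linarith [hσ.2])]
    exact hσ3
  have hσb := abs_inv_sub_one_le hσ.1 hσa
  have hρa : |1 - ρ| ≤ lam := by
    rw [abs_of_nonneg (by linarith)]
    exact hρ3
  have h2 : a / 2 ≤ p.D31 * p.σ lam := by
    have := mul_le_mul hA.1 hσ.1 (by norm_num) hA0.le
    linarith only [this]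
  refine ⟨θ / p.freq lam K, by positivity, ?_, ?_, ?_⟩
  · have h1 : κ * a / 2 * √lam ≤ p.freq lam K := by
      rw [hω, show κ * a / 2 * √lam = K * (a / 2) by rw [hKdef]; ring]
      exact mul_le_mul_of_nonneg_left h2 hK0.le
    rw [← mul_div_assoc, div_le_iff₀ hω0]
    have h3 : 16 / (κ * a) * (κ * a / 2 * √lam) = 8 * √lam := by
      field_simp
      norm_num
    have h4 := mul_le_mul_of_nonneg_left h1 (by positivity : 0 ≤ 16 / (κ * a))
    have h5 := mul_le_mul_of_nonneg_left hθ8 hs0.le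
    linarith only [h3, h4, h5]
  · rw [ellipse₁_eq hσ0, hT]
    have e : w₁ * Real.cos θ - p.σ lam * w₂ * Real.sin θ - p.γ
        = (1 - p.σ lam) * (w₂ * Real.sin θ) - (1 - ρ) * p.γ := by
      linear_combination r1
    rw [e]
    have := abs_sub_le_of_le (abs_mul_le_of_le hσa (abs_mul_le_of_le hw2 hsθ))
      (abs_mul_le_of_le hρa hγ1)
    linarith only [this, hba]
  · rw [ellipse₂_eq hσ0, hT]
    have e : w₂ * Real.cos θ + w₁ / p.σ lam * Real.sin θ - (-p.Ω)
        = ((p.σ lam)⁻¹ - 1) * (w₁ * Real.sin θ) + (1 - ρ) * p.Ω := by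
      rw [div_eq_mul_inv]
      linear_combination r2
    rw [e]
    have := abs_add_le_of_le (abs_mul_le_of_le hσb (abs_mul_le_of_le hw1 hsθ))
      (abs_mul_le_of_le hρa hΩ1)
    linarith only [this]

theorem E3_dist_le (v w : E3) : dist v w ≤ |v 0 - w 0| + |v 1 - w 1| + |v 2 - w 2| := by
  rw [dist_eq_norm]
  refine le_of_sq_le_sq ?_ (by positivity)
  rw [E3_norm_sq]
  simp only [PiLp.sub_apply]
  nlinarith [sq_abs (v 0 - w 0), sq_abs (v 1 - w 1), sq_abs (v 2 - w 2),
    mul_nonneg (abs_nonneg (v 0 - w 0)) (abs_nonneg (v 1 - w 1)),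
    mul_nonneg (abs_nonneg (v 0 - w 0)) (abs_nonneg (v 2 - w 2)),
    mul_nonneg (abs_nonneg (v 1 - w 1)) (abs_nonneg (v 2 - w 2))]

/-- The constant in the estimates for the transfer of the reference solution. -/
def transferConst (a b κ : ℝ) : ℝ :=
  3 * Real.exp (growthRate a b * (16 / (κ * a))) + 2 * (2 * (b / a) + 1) + 1

/-- The transfer current keeps the height constant up to `O(lam)` and carries the state from
`(w₁, w₂, -K)` into an `O(√lam)`-neighbourhood of `s⁺`. -/
theorem exists_transfer (hp : p ∈ paramSet a b) (ha : 0 < a) (ha1 : a < 1) (hl : 0 < lam)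
    (hl1 : lam ≤ 1) (hlb : lam * b ≤ a / 2) (hκ : 0 < κ) (hκ1 : κ ≤ 1)
    (hK2 : 2 * (κ * √lam) ^ 2 ≤ 1) (hw : w₁ ^ 2 + w₂ ^ 2 = 1 - (κ * √lam) ^ 2)
    (hlW : lam * (700 * b / a) ≤ 1 / 320) :
    ∃ T > 0, ∀ u : ℝ → E3, p.Solves lam (p.betaTr lam (κ * √lam) w₁ w₂) 0 T u →
      u 0 = !₂[w₁, w₂, -(κ * √lam)] →
      (∀ t ∈ Icc 0 T, |u t 2 - (-(κ * √lam))| ≤ transferConst a b κ * lam) ∧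
      dist (u T) p.sPlus ≤ transferConst a b κ * √lam := by
  obtain ⟨T, hT0, hT, he₁, he₂⟩ := exists_ellipse_near_target hp ha ha1 hl hlb hκ hκ1 hK2 hw
  refine ⟨T, hT0, fun u hu hu0 => ?_⟩
  have hb : 0 < b := by linarith [hp.2.1.1, hp.2.1.2]
  have hs0 : 0 < √lam := Real.sqrt_pos.2 hl
  have hs2 : √lam ^ 2 = lam := Real.sq_sqrt hl.le
  have hs1 : √lam ≤ 1 := by nlinarith
  have hG : 0 ≤ growthRate a b := by
    unfold growthRate driftBound heightRate currentBound
    positivity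
  set E := Real.exp (growthRate a b * (16 / (κ * a))) with hE
  have hE0 : 0 < E := Real.exp_pos _
  have hba : 0 ≤ b / a := by positivity
  have hC : transferConst a b κ = 3 * E + 2 * (2 * (b / a) + 1) + 1 := rfl
  have hmain : ∀ t ∈ Icc 0 T, |u t 0 - p.ellipse₁ lam (κ * √lam) w₁ w₂ t| ≤ E * √lam ∧
      |u t 1 - p.ellipse₂ lam (κ * √lam) w₁ w₂ t| ≤ E * √lam ∧
      |u t 2 + κ * √lam| ≤ E * lam := by
    intro t ht
    have h := Solves.sq_dist_ellipse_le hp ha hl hl1 hlb (mul_pos hκ hs0) hK2 hw hlW hu hu0 ht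
    have h1 : lam * Real.exp (2 * (√lam * growthRate a b) * t) ≤ (E * √lam) ^ 2 := by
      rw [mul_pow, hs2, hE, ← Real.exp_nat_mul, mul_comm]
      refine mul_le_mul_of_nonneg_right (Real.exp_le_exp.2 ?_) hl.le
      push_cast
      have h2 : √lam * t ≤ 16 / (κ * a) := (mul_le_mul_of_nonneg_left ht.2 hs0.le).trans hT
      nlinarith [mul_le_mul_of_nonneg_left h2 hG]
    have h2 := h.trans h1
    have hEs : 0 ≤ E * √lam := by positivity
    set X := (u t 2 + κ * √lam) / √lam with hX
    have q0 := sq_nonneg (u t 0 - p.ellipse₁ lam (κ * √lam) w₁ w₂ t)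
    have q1 := sq_nonneg (u t 1 - p.ellipse₂ lam (κ * √lam) w₁ w₂ t)
    have q2 := sq_nonneg X
    refine ⟨abs_le_of_sq_le_sq (by linarith only [h2, q1, q2]) hEs,
      abs_le_of_sq_le_sq (by linarith only [h2, q0, q2]) hEs, ?_⟩
    have h3 : |X| ≤ E * √lam := abs_le_of_sq_le_sq (by linarith only [h2, q0, q1]) hEs
    rw [hX, abs_div, abs_of_pos hs0, div_le_iff₀ hs0] at h3
    nlinarith
  constructor
  · intro t ht
    rw [sub_neg_eq_add]
    refine (hmain t ht).2.2.trans (mul_le_mul_of_nonneg_right ?_ hl.le)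
    rw [hC]
    linarith
  · obtain ⟨h0, h1, h2⟩ := hmain T (right_mem_Icc.2 hT0.le)
    have h := E3_dist_le (u T) p.sPlus
    simp only [sPlus, PiLp.toLp_apply, Matrix.cons_val, sub_zero] at h ⊢
    have d0 := abs_sub_le (u T 0) (p.ellipse₁ lam (κ * √lam) w₁ w₂ T) p.γ
    have d1 := abs_sub_le (u T 1) (p.ellipse₂ lam (κ * √lam) w₁ w₂ T) (-p.Ω)
    have d2 := abs_sub_abs_le_abs_sub (u T 2) (-(κ * √lam))
    rw [abs_neg, abs_of_pos (mul_pos hκ hs0), sub_neg_eq_add] at d2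
    have hls : lam ≤ √lam := by nlinarith
    have m1 : lam * (2 * (b / a) + 1) ≤ √lam * (2 * (b / a) + 1) :=
      mul_le_mul_of_nonneg_right hls (by positivity)
    have m2 : κ * √lam ≤ √lam := by nlinarith
    have m3 : E * lam ≤ E * √lam := mul_le_mul_of_nonneg_left hls hE0.le
    rw [hC]
    linarith

end Params

theorem SolvesOn.comp_add_const {F G : E3 → E3} {c t₀ t₁ : ℝ} {u : ℝ → E3}
    (hu : SolvesOn F G (fun _ => c) t₀ t₁ u) (d : ℝ) :
    SolvesOn F G (fun _ => c) (t₀ - d) (t₁ - d) (fun t => u (t + d)) :=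
  ⟨hu.1.comp (by fun_prop) fun _ ht => ⟨by linarith [ht.1], by linarith [ht.2]⟩,
    fun t ht => (hu.2 (t + d) ⟨by linarith [ht.1], by linarith [ht.2]⟩).comp_add_const t d⟩

namespace Params

variable {p : Params} {lam a b κ C T t₀ t₁ M : ℝ} {β : ℝ → ℝ} {u v : ℝ → E3}

/-! ### Solutions of the switched system -/

theorem IsSolution.solves_left (hu : p.IsSolution lam β t₀ {0, T} u) (hT : 0 < T) :
    p.Solves lam β t₀ 0 u :=
  hu.solves le_rfl fun t ht h => by
    rcases h with rfl | rfl
    · exact lt_irrefl _ ht.2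
    · exact lt_asymm hT ht.2

theorem IsSolution.solves_mid (hu : p.IsSolution lam β t₀ {0, T} u) (h0 : t₀ < 0) :
    p.Solves lam β 0 T u :=
  hu.solves h0.le fun t ht h => by
    rcases h with rfl | rfl
    · exact lt_irrefl _ ht.1
    · exact lt_irrefl _ ht.2

theorem IsSolution.solves_right (hu : p.IsSolution lam β t₀ {0, T} u) (h0 : t₀ < 0) (hT : 0 < T)
    (t₁ : ℝ) : p.Solves lam β T t₁ u :=
  hu.solves (h0.trans hT).le fun t ht h => by
    rcases h with rfl | rfl
    · exact lt_asymm hT ht.1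
    · exact lt_irrefl _ ht.1

theorem IsSolution.norm_eq_zero (hu : p.IsSolution lam β t₀ {0, T} u) (h0 : t₀ < 0)
    (hT : 0 < T) : ‖u 0‖ = ‖u t₀‖ :=
  Solves.norm_eq (hu.solves_left hT) (right_mem_Icc.2 h0.le)

theorem IsSolution.norm_eq_switch (hu : p.IsSolution lam β t₀ {0, T} u) (h0 : t₀ < 0)
    (hT : 0 < T) : ‖u T‖ = ‖u t₀‖ :=
  (Solves.norm_eq (hu.solves_mid h0) (right_mem_Icc.2 hT.le)).trans (hu.norm_eq_zero h0 hT)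

theorem Solves.eqOn (hu : p.Solves lam β t₀ t₁ u) (hv : p.Solves lam β t₀ t₁ v)
    (hβ : ∀ t, |β t| ≤ M) (h : u t₀ = v t₀) : EqOn u v (Icc t₀ t₁) :=
  SolvesOn.eqOn hu hv (p.contDiff_field lam 0) (contDiff_steer lam) (p.inner_field lam 0)
    (inner_steer lam) (fun t _ => hβ t) h

theorem IsSolution.eqOn (hu : p.IsSolution lam β t₀ {0, T} u)
    (hv : p.IsSolution lam β t₀ {0, T} v) (h0 : t₀ < 0) (hT : 0 < T) (hβ : ∀ t, |β t| ≤ M)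
    (h : u t₀ = v t₀) : EqOn u v (Ici t₀) := by
  have h1 := Solves.eqOn (hu.solves_left hT) (hv.solves_left hT) hβ h
  have h2 := Solves.eqOn (hu.solves_mid h0) (hv.solves_mid h0) hβ (h1 (right_mem_Icc.2 h0.le))
  intro t ht
  rcases le_total t 0 with h' | h'
  · exact h1 ⟨ht, h'⟩
  rcases le_total t T with h'' | h''
  · exact h2 ⟨h', h''⟩
  · exact Solves.eqOn (hu.solves_right h0 hT t) (hv.solves_right h0 hT t) hβ
      (h2 (right_mem_Icc.2 hT.le)) ⟨h'', le_rfl⟩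

theorem exists_isSolution_dist_le (p : Params) (lam : ℝ) (h0 : t₀ < 0) (hT : 0 < T)
    (hβ : ∀ t, |β t| ≤ M) : ∃ L > 0, ∀ u v : ℝ → E3, p.IsSolution lam β t₀ {0, T} u →
      p.IsSolution lam β t₀ {0, T} v → ‖u t₀‖ ≤ 2 → ‖v t₀‖ ≤ 2 →
      ∀ t ∈ Icc 0 T, dist (u t) (v t) ≤ L * dist (u t₀) (v t₀) := by
  obtain ⟨L, hL0, hL⟩ := exists_dist_le_mul_exp (p.contDiff_field lam 0) (contDiff_steer lam) 2 M
  refine ⟨Real.exp (L * (0 - t₀)) * Real.exp (L * T), by positivity,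
    fun u v hu hv hun hvn t ht => ?_⟩
  have h1 := hL β t₀ 0 u v (hu.solves_left hT) (hv.solves_left hT) (fun t _ => hβ t)
    (fun t ht => (Solves.norm_eq (hu.solves_left hT) (Ioo_subset_Icc_self ht)).trans_le hun)
    (fun t ht => (Solves.norm_eq (hv.solves_left hT) (Ioo_subset_Icc_self ht)).trans_le hvn)
    0 (right_mem_Icc.2 h0.le)
  have hu0 : ‖u 0‖ ≤ 2 := (hu.norm_eq_zero h0 hT).trans_le hun
  have hv0 : ‖v 0‖ ≤ 2 := (hv.norm_eq_zero h0 hT).trans_le hvn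
  have h2 := hL β 0 T u v (hu.solves_mid h0) (hv.solves_mid h0) (fun t _ => hβ t)
    (fun t ht => (Solves.norm_eq (hu.solves_mid h0) (Ioo_subset_Icc_self ht)).trans_le hu0)
    (fun t ht => (Solves.norm_eq (hv.solves_mid h0) (Ioo_subset_Icc_self ht)).trans_le hv0) t ht
  have h3 : Real.exp (L * (t - 0)) ≤ Real.exp (L * T) :=
    Real.exp_le_exp.2 (mul_le_mul_of_nonneg_left (by linarith [ht.2]) hL0)
  calc dist (u t) (v t) ≤ dist (u 0) (v 0) * Real.exp (L * (t - 0)) := h2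
    _ ≤ (dist (u t₀) (v t₀) * Real.exp (L * (0 - t₀))) * Real.exp (L * T) :=
        mul_le_mul h1 h3 (Real.exp_pos _).le (by positivity)
    _ = _ := by ring

theorem exists_isSolution_control (p : Params) (lam : ℝ) {βe : ℝ} {βtr : ℝ → ℝ}
    (hβtr : Continuous βtr) (h0 : t₀ < 0) (hT : 0 < T) (u₀ : E3) :
    ∃ u, p.IsSolution lam (control βe βtr T) t₀ {0, T} u ∧ u t₀ = u₀ := by
  have hF := p.contDiff_field lam 0
  have hG := contDiff_steer lam
  have hF' := p.inner_field lam 0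
  have hG' := inner_steer lam
  obtain ⟨u₁, h₁, h₁0⟩ := exists_solvesOn (β := fun _ => βe) hF hG hF' hG' h0.le
    continuousOn_const u₀
  obtain ⟨u₂, h₂, h₂0⟩ := exists_solvesOn (β := βtr) hF hG hF' hG' hT.le hβtr.continuousOn (u₁ 0)
  obtain ⟨u₃, h₃, h₃0⟩ := exists_solvesOn_Ici (β := fun _ => 0) hF hG hF' hG' T
    continuous_const (u₂ T)
  obtain ⟨u, hu, hu0⟩ := exists_isSolution_of_pieces (β := control βe βtr T) h0 hT
    (h₁.congr_control fun t ht => (if_pos ht.2).symm)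
    (h₂.congr_control fun t ht => by simp [control, not_lt.2 ht.1.le, ht.2.le])
    (fun t₁ => (h₃ t₁).congr_control fun t ht => by
      simp [control, not_lt.2 (hT.trans ht.1).le, not_le.2 ht.1]) h₂0 h₃0
  exact ⟨u, hu, hu0.trans h₁0⟩

/-! ### The vicinity of the target -/

theorem norm_sMinus (hp : p ∈ paramSet a b) (ha : 0 < a) : ‖p.sMinus‖ = 1 := by
  have h := E3_norm_sq p.sMinus
  have hγ := γ_sq hp ha
  simp only [sMinus, Matrix.cons_val] at h ⊢
  exact (pow_left_inj₀ (norm_nonneg _) zero_le_one two_ne_zero).1 (by linarith)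

theorem le_γ_sq (hp : p ∈ paramSet a b) (ha : 0 < a) (ha1 : a < 1) : a ≤ p.γ ^ 2 := by
  rw [γ_sq hp ha]
  nlinarith [hp.2.2.2.2.1, hp.2.2.2.2.2]

/-- If `κ` and `lam` are small, the transfer ends below a quarter of the energy barrier. -/
theorem energy_lt_of_transfer (hp : p ∈ paramSet a b) (ha : 0 < a) (ha1 : a < 1) (hl : 0 < lam)
    (hκb : 2 * b * κ ^ 2 ≤ a ^ 3 / 8)
    (hCl : 3 * b * C ^ 2 * lam ≤ a ^ 3 / 16) {w : E3} (hz : |w 2 - (-(κ * √lam))| ≤ C * lam)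
    (hw : dist w p.sPlus ≤ C * √lam) :
    0 < w 0 ∧ p.energy lam w < lam * p.Dt21 * (a / 2) ^ 2 := by
  have hγ := le_γ_sq hp ha ha1
  have hγ0 : 0 ≤ p.γ := Real.sqrt_nonneg _
  obtain ⟨-, hA, hd, -, -⟩ := hp
  have hb : 0 < b := by linarith [hA.1, hA.2]
  have hs2 : √lam ^ 2 = lam := Real.sq_sqrt hl.le
  have hCs : (C * √lam) ^ 2 = C ^ 2 * lam := by rw [mul_pow, hs2]
  have hcoord : ∀ i, |w i - p.sPlus i| ≤ C * √lam := fun i => by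
    have h := E3_abs_le_norm (w - p.sPlus) i
    rw [← dist_eq_norm] at h
    exact h.trans hw
  constructor
  · have h0 := (abs_le.1 (hcoord 0)).1
    simp only [sPlus, Matrix.cons_val] at h0
    have h1 : C ^ 2 * lam < a := by
      have hab : a ≤ b := hA.1.trans hA.2
      have h2 : b * (C ^ 2 * lam) < b * a := by
        have : a ^ 3 ≤ b * a := by nlinarith [mul_pos ha ha]
        nlinarith [mul_pos hb ha]
      exact lt_of_mul_lt_mul_left h2 hb.le
    have h3 : C * √lam < p.γ := lt_of_pow_lt_pow_left₀ 2 hγ0 (by rw [hCs]; linarith)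
    linarith
  · have h1 := hcoord 1
    simp only [sPlus, Matrix.cons_val, sub_neg_eq_add] at h1 hz
    have hq : (w 1 + p.Ω) ^ 2 ≤ C ^ 2 * lam := by
      rw [← hCs]
      exact sq_le_sq' (abs_le.1 h1).1 (abs_le.1 h1).2
    have hz1 : (w 2 + κ * √lam) ^ 2 ≤ (C * lam) ^ 2 := sq_le_sq' (abs_le.1 hz).1 (abs_le.1 hz).2
    have hz2 : w 2 ^ 2 ≤ 2 * (κ ^ 2 * lam) + 2 * (C ^ 2 * lam ^ 2) := by
      have e : (κ * √lam) ^ 2 = κ ^ 2 * lam := by rw [mul_pow, hs2]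
      nlinarith [sq_nonneg (w 2 + 2 * (κ * √lam))]
    have e1 : p.D31 * w 2 ^ 2 ≤ b * (2 * (κ ^ 2 * lam) + 2 * (C ^ 2 * lam ^ 2)) :=
      mul_le_mul hA.2 hz2 (sq_nonneg _) hb.le
    have e2 : lam * p.Dt21 * (w 1 + p.Ω) ^ 2 ≤ lam * b * (C ^ 2 * lam) :=
      mul_le_mul (mul_le_mul_of_nonneg_left hd.2 hl.le) hq (sq_nonneg _) (by positivity)
    have e3 : lam * a * (a / 2) ^ 2 ≤ lam * p.Dt21 * (a / 2) ^ 2 :=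
      mul_le_mul_of_nonneg_right (mul_le_mul_of_nonneg_left hd.1 hl.le) (sq_nonneg _)
    have e4 := mul_le_mul_of_nonneg_left (add_le_add hκb hCl) hl.le
    have e5 : 0 < lam * a ^ 3 := by positivity
    rw [energy]
    linarith only [e1, e2, e3, e4, e5]

/-- The equilibrium on the sphere of radius `R` moves at speed `1 / γ` at `R = 1`. -/
theorem eventually_abs_sqrt_sub_le (hp : p ∈ paramSet a b) (ha : 0 < a) (ha1 : a < 1) {f : ℝ}
    (hf : 1 / p.γ < f) :
    ∀ᶠ R in 𝓝 (1 : ℝ), |√(R ^ 2 - p.Ω ^ 2) - p.γ| ≤ f * |R - 1| := by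
  have hγ2 := γ_sq hp ha
  have hγa := le_γ_sq hp ha ha1
  have hγ0 : 0 < p.γ := (Real.sqrt_nonneg _).lt_of_ne' fun h => by
    rw [show p.γ = 0 from h] at hγa
    norm_num at hγa
    linarith
  have hd : HasDerivAt (fun R : ℝ => √(R ^ 2 - p.Ω ^ 2)) (1 / p.γ) 1 := by
    have h1 : HasDerivAt (fun R : ℝ => R ^ 2 - p.Ω ^ 2) 2 1 := by
      simpa using (hasDerivAt_pow 2 (1 : ℝ)).sub_const (p.Ω ^ 2)
    refine (h1.sqrt (by rw [one_pow, ← hγ2]; positivity)).congr_deriv ?_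
    rw [one_pow, ← γ]
    field_simp
  have h2 := hd.isLittleO.def (sub_pos.2 hf)
  filter_upwards [h2] with R hR
  rw [one_pow, ← γ, smul_eq_mul, Real.norm_eq_abs, Real.norm_eq_abs] at hR
  have h3 := abs_sub_abs_le_abs_sub (√(R ^ 2 - p.Ω ^ 2) - p.γ) ((R - 1) * (1 / p.γ))
  rw [abs_mul (R - 1), abs_of_pos (by positivity : 0 < 1 / p.γ)] at h3
  nlinarith

/-! ### The controlled switching -/

/-- The reference solution: under the constant current the solution started at `s⁻` reaches the
latitude `-K`, and the transfer current computed from the point reached there brings it near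
`s⁺`. -/
theorem exists_reference (hp : p ∈ paramSet a b) (ha : 0 < a) (ha1 : a < 1) (hl : 0 < lam)
    (hl1 : lam ≤ 1) (hlb : lam * b ≤ a / 2) (hκ : 0 < κ) (hκ1 : κ ≤ 1)
    (hK2 : 2 * (κ * √lam) ^ 2 ≤ 1) (hlW : lam * (700 * b / a) ≤ 1 / 320) :
    ∃ Te > 0, ∃ T > 0, ∃ w₁ w₂ M : ℝ, ∃ β : ℝ → ℝ, ∃ c : ℝ → E3,
      β = control (4 * b + 4 * b ^ 2 + 2) (p.betaTr lam (κ * √lam) w₁ w₂) T ∧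
      (∀ t, |β t| ≤ M) ∧ (∀ u₀, ∃ u, p.IsSolution lam β (-Te) {0, T} u ∧ u (-Te) = u₀) ∧
      p.IsSolution lam β (-Te) {0, T} c ∧ c (-Te) = p.sMinus ∧
      c 0 = !₂[w₁, w₂, -(κ * √lam)] ∧
      (∀ t ∈ Icc 0 T, |c t 2 - (-(κ * √lam))| ≤ transferConst a b κ * lam) ∧
      dist (c T) p.sPlus ≤ transferConst a b κ * √lam := by
  have hb : 0 < b := by linarith [hp.2.1.1, hp.2.1.2]
  have hK0 : 0 < κ * √lam := mul_pos hκ (Real.sqrt_pos.2 hl)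
  set βe := 4 * b + 4 * b ^ 2 + 2 with hβe
  set K := κ * √lam
  have hnorm := norm_sMinus hp ha
  obtain ⟨v, hv, hv0⟩ := exists_solvesOn (β := fun _ => βe) (p.contDiff_field lam 0)
    (contDiff_steer lam) (p.inner_field lam 0) (inner_steer lam)
    (by positivity : (0 : ℝ) ≤ 3 * K / lam) continuousOn_const p.sMinus
  obtain ⟨Te, hTe, hvz⟩ := Solves.exists_reach hp ha hl hl1 hlb hK0 hK2 hv
    (by rw [hv0, hnorm]) (by rw [hv0]; simp [sMinus])
  set w₁ := v Te 0
  set w₂ := v Te 1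
  have hw : w₁ ^ 2 + w₂ ^ 2 = 1 - K ^ 2 := by
    have h1 := Solves.norm_eq hv (Ioo_subset_Icc_self hTe)
    have h2 := E3_norm_sq (v Te)
    rw [h1, hv0, hnorm, hvz] at h2
    linarith
  obtain ⟨T, hT, htr⟩ := exists_transfer hp ha ha1 hl hl1 hlb hκ hκ1 hK2 hw hlW
  have hbd := abs_betaTr_le hp ha hl hl1 hlb hK0 hK2 hw hlW
  have hM : 0 ≤ currentBound b := by unfold currentBound; positivity
  set β := control βe (p.betaTr lam K w₁ w₂) T with hβ
  have hβM : ∀ t, |β t| ≤ βe + currentBound b := by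
    intro t
    have hβe0 : 0 < βe := by positivity
    simp only [hβ, control]
    split_ifs
    · rw [abs_of_pos hβe0]
      linarith
    · linarith [hbd t]
    · rw [abs_zero]
      linarith
  have hTe0 : -Te < 0 := neg_lt_zero.2 hTe.1
  have hex := exists_isSolution_control (βe := βe) p lam
    (continuous_betaTr hp ha hl hlb hK0 hK2 hw hlW) hTe0 hT
  obtain ⟨c, hc, hc0⟩ := hex p.sMinus
  have hshift : p.Solves lam β (-Te) 0 (fun t => v (t + Te)) := by
    have h := (SolvesOn.mono hv hTe.2.le).comp_add_const Te
    rw [zero_sub, sub_self] at h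
    exact h.congr_control fun t ht => (if_pos ht.2).symm
  have hczero : c 0 = !₂[w₁, w₂, -K] := by
    have h := Solves.eqOn (hc.solves_left hT) hshift hβM (by simp [hc0, hv0])
      (right_mem_Icc.2 hTe0.le)
    simp only [zero_add] at h
    rw [h]
    ext i
    fin_cases i
    · rfl
    · rfl
    · exact hvz
  obtain ⟨hz, hend⟩ := htr c ((hc.solves_mid hTe0).congr_control fun t ht => by
    simp [control, not_lt.2 ht.1.le, ht.2.le, K]) hczero
  exact ⟨Te, hTe.1, T, hT, w₁, w₂, _, β, c, rfl, hβM, hex, hc, hc0, hczero, hz, hend⟩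

end Params
end LLS

end

theorem theorem1 (a b : ℝ) (ha : 0 < a) (ha1 : a < 1) (hab : a < b) :
    ∃ lam₀ > 0, ∃ κ > 0, ∃ βe > 0, ∃ C > 0,
      lam₀ * b < a ∧ √2 * (κ * √lam₀) ≤ 1 ∧
      ∀ p ∈ LLS.paramSet a b, ∀ lam ∈ Ioc 0 lam₀,
        ∃ Te > 0, ∃ Ttr > 0, ∃ w₁ w₂ : ℝ, ∃ β : ℝ → ℝ,
          β = LLS.control βe (p.betaTr lam (κ * √lam) w₁ w₂) Ttr ∧
          (∃ c : ℝ → LLS.E3, p.IsSolution lam β (-Te) {0, Ttr} c ∧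
            c (-Te) = p.sMinus ∧ c 0 = !₂[w₁, w₂, -(κ * √lam)]) ∧
          ∀ f > 1 / p.γ, ∃ rMinus > 0, ∀ r ≤ rMinus,
            ∀ u₀ ∈ Metric.closedBall p.sMinus r,
              ∃ u : ℝ → LLS.E3, p.IsSolution lam β (-Te) {0, Ttr} u ∧ u (-Te) = u₀ ∧
                (∀ v : ℝ → LLS.E3, p.IsSolution lam β (-Te) {0, Ttr} v → v (-Te) = u₀ →
                  EqOn v u (Ici (-Te))) ∧
                (∃ uInf ∈ Metric.closedBall p.sPlus (f * r), Tendsto u atTop (𝓝 uInf)) ∧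
                p.IsCQL lam (κ * √lam) C w₁ w₂ Ttr β u := by
  have hb : 0 < b := ha.trans hab
  -- `κ` is so small that the height `K = κ √lam` costs at most half of the admissible energy.
  obtain ⟨κ, hκ, hκ4, hκb⟩ : ∃ κ > 0, κ ≤ 1 / 4 ∧ 2 * b * κ ^ 2 ≤ a ^ 3 / 8 := by
    refine ⟨a ^ 2 / (4 * (b + 1)), by positivity, ?_, ?_⟩
    · rw [div_le_iff₀ (by positivity)]
      nlinarith
    · rw [div_pow, ← mul_div_assoc, div_le_iff₀ (by positivity)]
      have h1 : a ^ 4 ≤ a ^ 3 := pow_le_pow_of_le_one ha.le ha1.le (by norm_num)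
      have h2 : b ≤ (b + 1) ^ 2 := by nlinarith
      have h3 := mul_le_mul h1 h2 hb.le (by positivity)
      linarith
  set C₁ := LLS.Params.transferConst a b κ with hC₁
  have hC₁0 : 0 < C₁ := by
    rw [hC₁, LLS.Params.transferConst]
    positivity
  -- Besides the bounds from the transfer, `lam` has to keep the error terms in the energy small.
  obtain ⟨lam₀, hlam₀, h1, h2, h3, h4⟩ : ∃ lam₀ > 0, lam₀ ≤ 1 ∧ lam₀ * b ≤ a / 2 ∧
      lam₀ * (700 * b / a) ≤ 1 / 320 ∧ lam₀ * (3 * b * C₁ ^ 2) ≤ a ^ 3 / 16 := by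
    have hsmall : ∀ x y : ℝ, 0 < x → 0 < y → ∃ l > 0, ∀ l' ≤ l, l' * x ≤ y := fun x y hx hy =>
      ⟨y / x, by positivity, fun l' h => (le_div_iff₀ hx).1 h⟩
    obtain ⟨l₁, hl₁, h₁⟩ := hsmall b (a / 2) hb (by positivity)
    obtain ⟨l₂, hl₂, h₂⟩ := hsmall (700 * b / a) (1 / 320) (by positivity) (by norm_num)
    obtain ⟨l₃, hl₃, h₃⟩ := hsmall (3 * b * C₁ ^ 2) (a ^ 3 / 16) (by positivity) (by positivity)
    exact ⟨min (min 1 l₁) (min l₂ l₃), by positivity,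
      (min_le_left _ _).trans (min_le_left _ _),
      h₁ _ ((min_le_left _ _).trans (min_le_right _ _)),
      h₂ _ ((min_le_right _ _).trans (min_le_left _ _)),
      h₃ _ ((min_le_right _ _).trans (min_le_right _ _))⟩
  refine ⟨lam₀, hlam₀, κ, hκ, 4 * b + 4 * b ^ 2 + 2, by positivity, C₁ + 1, by positivity,
    by linarith, ?_, ?_⟩
  · have hs : √lam₀ ≤ 1 := Real.sqrt_le_one.2 h1
    have hs2 : √2 ≤ 2 := by
      rw [Real.sqrt_le_left (by norm_num)]
      norm_num
    have h5 : κ * √lam₀ ≤ 1 / 4 * 1 := mul_le_mul hκ4 hs (Real.sqrt_nonneg _) (by norm_num)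
    have h6 := mul_le_mul hs2 h5 (by positivity) (by norm_num)
    linarith
  intro p hp lam hlam
  have hl : 0 < lam := hlam.1
  have hl1 : lam ≤ 1 := hlam.2.trans h1
  have hlb : lam * b ≤ a / 2 := (mul_le_mul_of_nonneg_right hlam.2 hb.le).trans h2
  have hlW : lam * (700 * b / a) ≤ 1 / 320 :=
    (mul_le_mul_of_nonneg_right hlam.2 (by positivity)).trans h3
  have hlC : 3 * b * C₁ ^ 2 * lam ≤ a ^ 3 / 16 := by
    have := mul_le_mul_of_nonneg_right hlam.2 (by positivity : 0 ≤ 3 * b * C₁ ^ 2)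
    linarith
  have hs0 : 0 < √lam := Real.sqrt_pos.2 hl
  have hs1 : √lam ≤ 1 := Real.sqrt_le_one.2 hl1
  have hK2 : 2 * (κ * √lam) ^ 2 ≤ 1 := by
    have h5 : κ * √lam ≤ 1 / 4 * 1 := mul_le_mul hκ4 hs1 hs0.le (by norm_num)
    have h6 : 0 < κ * √lam := by positivity
    nlinarith
  obtain ⟨Te, hTe, T, hT, w₁, w₂, M, β, c, hβ, hβM, hex, hc, hc0, hczero, hcz, hcT⟩ :=
    LLS.Params.exists_reference hp ha ha1 hl hl1 hlb hκ (by linarith) hK2 hlW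
  have hTe0 : -Te < 0 := neg_lt_zero.2 hTe
  refine ⟨Te, hTe, T, hT, w₁, w₂, β, hβ, ⟨c, hc, hc0, hczero⟩, fun f hf => ?_⟩
  obtain ⟨L, hL0, hL⟩ := LLS.Params.exists_isSolution_dist_le p lam hTe0 hT hβM
  -- The set of states which the uncontrolled flow carries to the target is open.
  have hbasin : ∀ᶠ w in 𝓝 (c T), 0 < w 0 ∧
      p.energy lam w < lam * p.Dt21 * (a / 2) ^ 2 := by
    obtain ⟨h5, h6⟩ := LLS.Params.energy_lt_of_transfer hp ha ha1 hl hκb hlC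
      (hcz T (right_mem_Icc.2 hT.le)) hcT
    have h7 : Continuous fun w : LLS.E3 => w 0 := by fun_prop
    exact (h7.continuousAt.eventually (lt_mem_nhds h5)).and
      (LLS.Params.continuous_energy.continuousAt.eventually (gt_mem_nhds h6))
  obtain ⟨ε₁, hε₁, hball⟩ := Metric.eventually_nhds_iff.1 hbasin
  obtain ⟨ε₂, hε₂, hequi⟩ := Metric.eventually_nhds_iff.1
    (LLS.Params.eventually_abs_sqrt_sub_le hp ha ha1 hf)
  obtain ⟨rMinus, hr0, hr1, hr2, hr3, hr4⟩ : ∃ r > 0, r ≤ a / 16 ∧ r < ε₂ ∧ L * r ≤ lam ∧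
      L * r < ε₁ := by
    refine ⟨min (min (a / 16) (ε₂ / 2)) (min (lam / L) (ε₁ / (2 * L))), by positivity,
      (min_le_left _ _).trans (min_le_left _ _),
      ((min_le_left _ _).trans (min_le_right _ _)).trans_lt (by linarith), ?_, ?_⟩
    · have h5 := mul_le_mul_of_nonneg_left ((min_le_right (min (a / 16) (ε₂ / 2)) _).trans
        (min_le_left (lam / L) (ε₁ / (2 * L)))) hL0.le
      rwa [mul_div_cancel₀ _ hL0.ne'] at h5
    · have h5 := mul_le_mul_of_nonneg_left ((min_le_right (min (a / 16) (ε₂ / 2)) _).trans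
        (min_le_right (lam / L) (ε₁ / (2 * L)))) hL0.le
      have h6 : L * (ε₁ / (2 * L)) = ε₁ / 2 := by field_simp
      linarith
  refine ⟨rMinus, hr0, fun r hr u₀ hu₀ => ?_⟩
  obtain ⟨u, hu, hu0⟩ := hex u₀
  rw [Metric.mem_closedBall] at hu₀
  have hr00 : 0 ≤ r := dist_nonneg.trans hu₀
  have hnorm := LLS.Params.norm_sMinus hp ha
  have hR : |‖u₀‖ - 1| ≤ r := by
    have := abs_norm_sub_norm_le u₀ p.sMinus
    rw [hnorm, ← dist_eq_norm] at this
    exact this.trans hu₀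
  have hR' := abs_le.1 hR
  have hR2 : 1 - a / 8 ≤ ‖u₀‖ ^ 2 := by
    have h5 : (1 - a / 16) ^ 2 ≤ ‖u₀‖ ^ 2 := pow_le_pow_left₀ (by linarith) (by linarith) 2
    linarith [sq_nonneg a]
  have hdist : ∀ t ∈ Icc 0 T, dist (u t) (c t) ≤ L * r := fun t ht => by
    have h5 := hL u c hu hc (by rw [hu0]; linarith) (by rw [hc0, hnorm]; norm_num) t ht
    rw [hu0, hc0] at h5
    exact h5.trans (mul_le_mul_of_nonneg_left hu₀ hL0.le)
  have hLr : L * r ≤ L * rMinus := mul_le_mul_of_nonneg_left hr hL0.le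
  have huT : ‖u T‖ = ‖u₀‖ := by rw [hu.norm_eq_switch hTe0 hT, hu0]
  obtain ⟨hx, hE⟩ := hball ((hdist T (right_mem_Icc.2 hT.le)).trans_lt (hLr.trans_lt hr4))
  have hlim := LLS.Params.Solves.tendsto_equilibrium (T := T) (u := u) hp ha ha1 hl hlb
    (fun t₁ => (hu.solves_right hTe0 hT t₁).congr_control fun t ht => by
      simp [hβ, LLS.control, not_lt.2 (hT.trans ht.1).le, not_le.2 ht.1])
    (by rw [huT]; exact hR2) hx hE.le
  refine ⟨u, hu, hu0, fun v hv hv0 => hv.eqOn hu hTe0 hT hβM (by rw [hv0, hu0]),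
    ⟨_, ?_, hlim⟩, ?_, ?_, ?_⟩
  · rw [Metric.mem_closedBall]
    refine (LLS.Params.E3_dist_le _ _).trans ?_
    simp only [LLS.Params.sPlus, Matrix.cons_val, sub_self, abs_zero, add_zero, huT]
    have hγ0 : 0 ≤ p.γ := Real.sqrt_nonneg _
    have hf0 : 0 ≤ f := (by positivity : 0 ≤ 1 / p.γ).trans hf.le
    exact (hequi (by rw [Real.dist_eq]; linarith)).trans (mul_le_mul_of_nonneg_left hR hf0)
  · intro t ht
    simp [hβ, LLS.control, not_lt.2 ht.1, ht.2]
  · intro t ht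
    have h5 := LLS.E3_abs_le_norm (u t - c t) 2
    rw [← dist_eq_norm, PiLp.sub_apply] at h5
    have h6 := abs_sub_le (u t 2) (c t 2) (-(κ * √lam))
    have h7 := hdist t ht
    have h8 := hcz t ht
    linarith
  · have h5 := dist_triangle (u T) (c T) p.sPlus
    have h6 := hdist T (right_mem_Icc.2 hT.le)
    have h7 : lam ≤ √lam := by
      have h8 := mul_le_of_le_one_left hs0.le hs1
      rwa [Real.mul_self_sqrt hl.le] at h8
    linarith
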